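/- Let $k\ge 2$. A $k$-uniform hypergraph with loops $H$ consists of a finite set $V(H)$ and a collection $E(H)$ of $k$-element multisets of elements of $V(H)$; a labeled copy of $F$ in $H$ is an injection $V(F)\to V(H)$ that maps every edge of $F$ to an edge of $H$. Let $\pi$ be a proper partition of $k$, that is, an unordered list of $t\ge 2$ positive integers with sum $k$; an ordering of $\pi$ is a tuple $\vec\pi=(k_1,\dots,k_t)$ of its entries. Cycles. The step $S_{\vec\pi}$ has vertex set $(A\times[k_1])\sqcup(B_2\times[k_2])\sqcup\dots\sqcup(B_t\times[k_t])$, where $A=\{0,1\}^{t-1}$ and each $B_j=\{0,1\}^{t-2}$. It has one edge for each $a\in A$, namely $(\{a\}\times[k_1])\cup\bigcup_{j=1}^{t-1}(\{b_{j+1}\}\times[k_{j+1}])$, where $b_{j+1}\in B_{j+1}$ is $a$ with its $j$-th bit removed. For $\ell\ge1$, the cycle $C_{\vec\pi,4\ell}$ is formed from $2\ell$ copies of $S_{\vec\pi}$, arranged cyclically, by identifying, for every $u\in\{0,1\}^{t-2}$ and $r\in[k_1]$, the vertex $(u1,r)$ of each copy with the vertex $(u0,r)$ of the next copy. Eigenvalues.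 For an $n$-vertex $H$, let $W=\mathbb R^{V(H)}$ with standard basis $(e_v)$, and let $\tau_H$ and $J$ be the $k$-linear maps $W^k\to\mathbb R$ such that $\tau_H(e_{v_1},\dots,e_{v_k})$ is $1$ if $\{v_1,\dots,v_k\}\in E(H)$ and $0$ otherwise, and $J(e_{v_1},\dots,e_{v_k})=1$. For a $k$-linear $\sigma:W^k\to\mathbb R$, let $\sigma_{\vec\pi}:W^{\otimes k_1}\times\dots\times W^{\otimes k_t}\to\mathbb R$ be the $t$-linear map with $\sigma_{\vec\pi}(b_{1,1}\otimes\dots\otimes b_{1,k_1},\dots,b_{t,1}\otimes\dots\otimes b_{t,k_t})=\sigma(b_{1,1},\dots,b_{1,k_1},\dots,b_{t,1},\dots,b_{t,k_t})$ for standard basis vectors $b_{i,j}$ of $W$. The spectral norm of a $t$-linear map $\phi$ is $\|\phi\|=\sup\{|\phi(x_1,\dots,x_t)|:\|x_i\|=1 \text{ for all } i\}$, with Euclidean norms. Put $$\lambda_{1,\vec\pi}(H)=\|\tau_{\vec\pi}\|,\qquad \lambda_{2,\vec\pi}(H)=\Big\|\tau_{\vec\pi}-\frac{k!\,|E(H)|}{n^k}J_{\vec\pi}\Big\|,\qquad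 \tau=\tau_H.$$ Theorem. Let $0<p<1$ be fixed, let $(H_n)$ be a sequence of $k$-uniform hypergraphs with loops with $|V(H_n)|=n$ and $|E(H_n)|\ge p\binom nk$, let $\pi$ be a proper partition of $k$, and let $\ell\ge1$. Suppose that for some ordering $\vec\pi$ of $\pi$ the number of labeled copies of $C=C_{\vec\pi,4\ell}$ in $H_n$ is at most $p^{|E(C)|}n^{|V(C)|}+o(n^{|V(C)|})$. Then, for every ordering $\vec\pi'$ of $\pi$, $\lambda_{1,\vec\pi'}(H_n)=pn^{k/2}+o(n^{k/2})$ and $\lambda_{2,\vec\pi'}(H_n)=o(n^{k/2})$ as $n\to\infty$. -/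

import Mathlib

open Filter Asymptotics

/-- A `k`-uniform hypergraph with loops on the vertex set `V`: a collection of `k`-element
multisets of elements of `V`. -/
structure LoopHypergraph (V : Type*) (k : ℕ) where
  /-- the edge set; `Sym V k` is the type of multisets of elements of `V` of cardinality `k` -/
  edges : Finset (Sym V k)

/-- The `k`-element multiset `{f 0, …, f (k - 1)}`. -/
def symOfFn {V : Type*} {k : ℕ} (f : Fin k → V) : Sym V k :=
  ⟨Finset.univ.val.map f, by simp⟩

namespace LoopHypergraph

/-- The number of labeled copies of `F` in `H`: edge-preserving injections `V(F) → V(H)`. -/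
noncomputable def labeledCopies {U V : Type*} {k : ℕ}
    (F : LoopHypergraph U k) (H : LoopHypergraph V k) : ℕ :=
  Nat.card {f : U ↪ V // ∀ e ∈ F.edges, Sym.map f e ∈ H.edges}

end LoopHypergraph

section Multilinear

/-- The `t`-linear form with coefficients `a`, where the basis vectors of all the factors are
selected simultaneously: `(x_j)_j ↦ ∑_v a(v) ∏_j x_j (s_j(v))`. -/
noncomputable def formOfCoeff {I ι : Type*} [Fintype I] [Fintype ι] {B : ι → Type*}
    [∀ j, Fintype (B j)] (s : ∀ j, I → B j) (a : I → ℝ) :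
    MultilinearMap ℝ (fun j : ι => EuclideanSpace ℝ (B j)) ℝ :=
  ∑ v : I, a v • (MultilinearMap.mkPiAlgebra ℝ ι ℝ).compLinearMap
    (fun j => (EuclideanSpace.proj (s j v) : EuclideanSpace ℝ (B j) →L[ℝ] ℝ).toLinearMap)

variable {V : Type*} [Fintype V] {k : ℕ}

open Classical in
/-- The adjacency map of `H`: the `k`-linear form on `W = ℝ^V` with
`τ(e_{v_1}, …, e_{v_k}) = 1` if `{v_1, …, v_k}` is an edge and `0` otherwise. -/
noncomputable def adjacencyMap (H : LoopHypergraph V k) :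
    MultilinearMap ℝ (fun _ : Fin k => EuclideanSpace ℝ V) ℝ :=
  formOfCoeff (fun j (v : Fin k → V) => v j) (fun v => if symOfFn v ∈ H.edges then 1 else 0)

/-- The all-ones map: the `k`-linear form on `ℝ^V` with `J(e_{v_1}, …, e_{v_k}) = 1` always. -/
noncomputable def allOnesMap (V : Type*) [Fintype V] (k : ℕ) :
    MultilinearMap ℝ (fun _ : Fin k => EuclideanSpace ℝ V) ℝ :=
  formOfCoeff (fun j (v : Fin k → V) => v j) (fun _ => 1)

/-- For an ordered partition `c = (k_1, …, k_t)` of `k`, the `t`-linear form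
`σ_c : W^{⊗k_1} × ⋯ × W^{⊗k_t} → ℝ` attached to the `k`-linear form `σ` on `W = ℝ^V`.
Here `W^{⊗m}` is the Euclidean space with orthonormal basis indexed by `V^m`, the index
`(v_1, …, v_m)` standing for `e_{v_1} ⊗ ⋯ ⊗ e_{v_m}`; the value of `σ_c` at the basis vectors that
are indexed by the consecutive blocks of `(v_1, …, v_k)` is `σ(e_{v_1}, …, e_{v_k})`. -/
noncomputable def flatten (σ : MultilinearMap ℝ (fun _ : Fin k => EuclideanSpace ℝ V) ℝ)
    (c : Composition k) :
    MultilinearMap ℝ (fun i : Fin c.length => EuclideanSpace ℝ (Fin (c.blocksFun i) → V)) ℝ :=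
  formOfCoeff (fun i (v : Fin k → V) => fun r => v (c.embedding i r))
    (fun v => σ (fun j => EuclideanSpace.basisFun V ℝ (v j)))

/-- The spectral norm of a multilinear form: the supremum of `|φ(x_1, …, x_t)|` over unit
vectors `x_i`. -/
noncomputable def formSpectralNorm {ι : Type*} {E : ι → Type*} [∀ i, NormedAddCommGroup (E i)]
    [∀ i, NormedSpace ℝ (E i)] (φ : MultilinearMap ℝ E ℝ) : ℝ :=
  sSup {r : ℝ | ∃ x : ∀ i, E i, (∀ i, ‖x i‖ = 1) ∧ r = |φ x|}

/-- The largest eigenvalue of `H` with respect to the ordered partition `c`. -/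
noncomputable def eig1 (H : LoopHypergraph V k) (c : Composition k) : ℝ :=
  formSpectralNorm (flatten (adjacencyMap H) c)

/-- The second largest eigenvalue of `H` with respect to the ordered partition `c`. -/
noncomputable def eig2 (H : LoopHypergraph V k) (c : Composition k) : ℝ :=
  formSpectralNorm (flatten (adjacencyMap H) c -
    ((k.factorial * H.edges.card : ℝ) / (Fintype.card V : ℝ) ^ k) • flatten (allOnesMap V k) c)

end Multilinear

section Cycle

/-- The code of length `t - 2` obtained from a code of length `t - 1` by removing the bit in
position `q` (positions are counted from `0`). -/
def removeBit {t : ℕ} (s : Fin (t - 1) → Bool) (q : ℕ) : Fin (t - 2) → Bool :=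
  fun i => s ⟨if (i : ℕ) < q then i else i + 1, by have := i.2; split <;> omega⟩

/-- The last bit of a code of length `t - 1` (only used for `t ≥ 2`). -/
def lastBit {t : ℕ} (s : Fin (t - 1) → Bool) : Bool :=
  if h : t - 2 < t - 1 then s ⟨t - 2, h⟩ else false

variable {k : ℕ}

/-- The vertices of the step of type `c = (k_1, …, k_t)`. The places `0, …, k - 1` of an edge are
cut into consecutive blocks of sizes `k_1, …, k_t`, and `c.index r` is the block (counted from `0`)
of the place `r`. The left summand is `A × [k_1]`, with codes of length `t - 1`, and the right
summand is the disjoint union of the `B_j × [k_j]` for `2 ≤ j ≤ t`, with codes of length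
`t - 2`. -/
abbrev StepVertex (c : Composition k) : Type :=
  ((Fin (c.length - 1) → Bool) × {r : Fin k // (c.index r : ℕ) = 0}) ⊕
    ((Fin (c.length - 2) → Bool) × {r : Fin k // (c.index r : ℕ) ≠ 0})

/-- The place `r` of the edge of the step that belongs to the code `s` of a vertex of `A`. In the
block `j + 1` with `j ≥ 1` (blocks counted from `1`) the code is `s` without its `j`-th bit. -/
def stepPlace (c : Composition k) (s : Fin (c.length - 1) → Bool) (r : Fin k) : StepVertex c :=
  if h : (c.index r : ℕ) = 0 then Sum.inl (s, ⟨r, h⟩)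
  else Sum.inr (removeBit s ((c.index r : ℕ) - 1), ⟨r, h⟩)

/-- The step of type `c`. -/
def stepHypergraph (c : Composition k) : LoopHypergraph (StepVertex c) k where
  edges := Finset.univ.image fun s : Fin (c.length - 1) → Bool => symOfFn (stepPlace c s)

/-- The vertices of the cycle that is glued from `N` steps of type `c`, cyclically, the second
attach tuple of each step (codes of vertices of `A` that end with `1`) being identified with the
first attach tuple of the next step (codes that end with `0`). Vertex `(i, u, r)` is, for `r` in the
first block, the vertex with code `u0` of `A` in step `i`, which is also the vertex with code `u1` of
`A` in the step before; for `r` in another block, it is the vertex with code `u` of that block's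
`B_j` in step `i`. -/
abbrev CycleVertex (c : Composition k) (N : ℕ) : Type :=
  Fin N × (Fin (c.length - 2) → Bool) × Fin k

/-- The map that sends the vertices of the `i`-th step to their classes in the cycle;
`finRotate N` is the cyclic successor on `Fin N`. -/
def glueStep (c : Composition k) (N : ℕ) (i : Fin N) : StepVertex c → CycleVertex c N
  | Sum.inl (s, r) =>
      (if lastBit s then finRotate N i else i, removeBit s (c.length - 2), (r : Fin k))
  | Sum.inr (u, r) => (i, u, (r : Fin k))

/-- The cycle of type `c` glued from `N` steps, which has length `2 * N`. -/
def cycleHypergraph (c : Composition k) (N : ℕ) : LoopHypergraph (CycleVertex c N) k where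
  edges := Finset.univ.biUnion fun i : Fin N =>
    (stepHypergraph c).edges.image (Sym.map (glueStep c N i))

end Cycle

/-! Fix an ordering `c` of the partition and regard the edge indicator `g` of `H` as a function of
`t` blocks of vertices. Fixing the two attach tuples of a step and averaging over its other vertices
gives a symmetric kernel `K`, normalised so that `tr K ^ N` is the homomorphism density of the cycle
with `N` steps. Since a step arises from half a step by doubling the next to last block, `K` is a
Gram matrix, hence positive semidefinite, with trace at most `1`; by Cauchy–Schwarz, its Rayleigh
quotient at the constant vector is at least `a = μ ^ (2 ^ (t - 1))`, where `μ` is the edge density.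
Hence the density of the cycle is at least `a ^ N`, and if it is close to `a ^ N`, then one
eigenvalue is close to `a`, the others are close to `0`, and so `tr K ^ 2` is close to
`a ^ 2 = μ ^ (2 ^ t)`.

The number `tr K ^ 2` is the box form of `g`, the analogue of the `2 ^ t`-th power of a Gowers norm,
and it does not depend on the order of the blocks. A function whose box form is nearly minimal for
its mean cannot be told from that mean by products of functions of one block, as follows by the
Cauchy–Schwarz inequality one block at a time. For every ordering of the partition this bounds the
spectral norm of the flattening of `τ - μ J`, and with it both eigenvalues.
-/

section Expectation

open Finset
open scoped BigOperators

theorem expect_eq_expect_snoc {M α : Type*} [AddCommMonoid M] [Module ℚ≥0 M] [Fintype α] {n : ℕ}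
    (f : (Fin (n + 1) → α) → M) :
    𝔼 z, f z = 𝔼 p : Fin n → α, 𝔼 w : α, f (Fin.snoc p w) := by
  rw [expect_comm, ← expect_product' univ univ fun (w : α) (p : Fin n → α) => f (Fin.snoc p w),
    univ_product_univ]
  exact (Fintype.expect_equiv (Fin.snocEquiv fun _ => α) _ _ fun _ => rfl).symm

theorem expect_eq_expect_expect_cond_last {M W : Type*} [AddCommMonoid M] [Module ℚ≥0 M]
    [Fintype W] {r : ℕ} (f : ((Fin (r + 1) → Bool) → W) → M) :
    𝔼 w, f w = 𝔼 y : (Fin r → Bool) → W, 𝔼 y' : (Fin r → Bool) → W,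
      f fun s => (bif s (Fin.last r) then y' else y) (Fin.init s) := by
  have hsplit (w : (Fin (r + 1) → Bool) → W) (s : Fin (r + 1) → Bool) :
      (bif s (Fin.last r) then fun u => w (Fin.snoc u true) else fun u => w (Fin.snoc u false))
        (Fin.init s) = w s := by
    conv_rhs => rw [← Fin.snoc_init_self s]
    cases s (Fin.last r) <;> rfl
  rw [← expect_product', univ_product_univ]
  exact Fintype.expect_equiv
    { toFun := fun w => (fun u => w (Fin.snoc u false), fun u => w (Fin.snoc u true))
      invFun := fun y s => (bif s (Fin.last r) then y.2 else y.1) (Fin.init s)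
      left_inv := fun w => funext (hsplit w)
      right_inv := fun y => by simp } _ _ fun w => congrArg f (funext (hsplit w)).symm

theorem prod_expect {K ι α : Type*} [Semifield K] [CharZero K] [Fintype ι] [DecidableEq ι]
    [Fintype α] (f : ι → α → K) : ∏ i, 𝔼 a, f i a = 𝔼 w : ι → α, ∏ i, f i (w i) := by
  simp only [Fintype.expect_eq_sum_div_card, prod_div_distrib, prod_univ_sum,
    Fintype.piFinset_univ]
  simp

theorem expect_prod_comp {K ι α : Type*} [Semifield K] [CharZero K] [Fintype ι] [DecidableEq ι]
    [Fintype α] (x : α → K) : 𝔼 w : ι → α, ∏ i, x (w i) = (𝔼 a, x a) ^ Fintype.card ι := by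
  rw [← prod_expect, prod_const, card_univ]

theorem expect_sub_expect_sq {K α : Type*} [Field K] [CharZero K] [Fintype α] [Nonempty α]
    (f : α → K) : 𝔼 a, (f a - 𝔼 b, f b) ^ 2 = 𝔼 a, f a ^ 2 - (𝔼 b, f b) ^ 2 := by
  simp only [sub_sq, expect_add_distrib, expect_sub_distrib, ← expect_mul, ← mul_expect,
    Fintype.expect_const]
  ring

theorem sq_expect_prod_mul_le {ι α : Type*} [Fintype ι] [DecidableEq ι] [Fintype α] {x : α → ℝ}
    (hx : 𝔼 a, x a ^ 2 ≤ 1) (G : (ι → α) → ℝ) :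
    (𝔼 w, (∏ i, x (w i)) * G w) ^ 2 ≤ 𝔼 w, G w ^ 2 := by
  refine (expect_mul_sq_le_sq_mul_sq _ _ _).trans
    (mul_le_of_le_one_left (expect_nonneg fun _ _ => sq_nonneg _) ?_)
  simp only [← prod_pow]
  rw [expect_prod_comp fun a => x a ^ 2]
  exact pow_le_one₀ (expect_nonneg fun _ _ => sq_nonneg _) hx

end Expectation

section BoxForm

open Finset
open scoped BigOperators

variable {Ω : Type*} [Fintype Ω] {r : ℕ}

/-- The box form of a family of `2 ^ r` functions of `r` variables: the average over `w` of
`∏ s, F s (j ↦ w_j (s without its bit j))`. It is defined by recursion on the last variable, which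
is how the Cauchy–Schwarz inequality is applied to it; `boxForm_eq_expect` is the closed form. -/
noncomputable def boxForm : (r : ℕ) → ((Fin r → Bool) → (Fin r → Ω) → ℝ) → ℝ
  | 0, F => F ![] ![]
  | r + 1, F => 𝔼 w : (Fin r → Bool) → Ω,
      ∏ b : Bool, boxForm r fun s p => F (Fin.snoc s b) (Fin.snoc p (w s))

/-- The box form with all `2 ^ r` functions equal to `g`; the counterpart for this box form of the
`2 ^ r`-th power of a Gowers norm. -/
noncomputable def boxValue (r : ℕ) (g : (Fin r → Ω) → ℝ) : ℝ := boxForm r fun _ => g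

/-- The function that remains after averaging `g` over its last variable with weight `x`. -/
noncomputable def lastAverage (g : (Fin (r + 1) → Ω) → ℝ) (x : Ω → ℝ) (p : Fin r → Ω) : ℝ :=
  𝔼 a, x a * g (Fin.snoc p a)

/-- The box form of the slices of `g` at the values `w s` of its last variable. -/
noncomputable def boxSlice (g : (Fin (r + 1) → Ω) → ℝ) (w : (Fin r → Bool) → Ω) : ℝ :=
  boxForm r fun s p => g (Fin.snoc p (w s))

theorem boxForm_const_mul (c : (Fin r → Bool) → ℝ) (F : (Fin r → Bool) → (Fin r → Ω) → ℝ) :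
    boxForm r (fun s p => c s * F s p) = (∏ s, c s) * boxForm r F := by
  induction r with
  | zero => simp [boxForm, Matrix.empty_eq]
  | succ r ih =>
    simp only [boxForm, ih, prod_mul_distrib, ← mul_expect]
    congr 1
    rw [← (Fin.snocEquiv fun _ : Fin (r + 1) => Bool).prod_comp, Fintype.prod_prod_type]
    rfl

theorem boxForm_expect {W : Type*} [Fintype W] (F : (Fin r → Bool) → W → (Fin r → Ω) → ℝ) :
    boxForm r (fun s p => 𝔼 a, F s a p) =
      𝔼 w : (Fin r → Bool) → W, boxForm r fun s p => F s (w s) p := by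
  induction r with
  | zero =>
    simp only [boxForm]
    refine (Fintype.expect_equiv (Equiv.funUnique (Fin 0 → Bool) W) _ _ fun w => ?_).symm
    simp only [Equiv.funUnique_apply, Matrix.empty_eq]
  | succ r ih =>
    simp only [boxForm, ih, Fintype.prod_bool]
    rw [expect_comm]
    refine expect_congr rfl fun w _ => ?_
    rw [expect_eq_expect_expect_cond_last, mul_comm, Fintype.expect_mul_expect]
    simp [mul_comm]

theorem boxValue_succ (g : (Fin (r + 1) → Ω) → ℝ) :
    boxValue (r + 1) g = 𝔼 w, boxSlice g w ^ 2 := by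
  simp [boxValue, boxForm, boxSlice, sq]

theorem boxValue_lastAverage (g : (Fin (r + 1) → Ω) → ℝ) (x : Ω → ℝ) :
    boxValue r (lastAverage g x) = 𝔼 w, (∏ s, x (w s)) * boxSlice g w := by
  unfold boxValue lastAverage
  rw [boxForm_expect]
  exact expect_congr rfl fun w _ => boxForm_const_mul (fun s => x (w s)) _

theorem expect_mul_prod_succ (g : (Fin (r + 1) → Ω) → ℝ) (x : Fin (r + 1) → Ω → ℝ) :
    𝔼 z, g z * ∏ j, x j (z j) =
      𝔼 p, lastAverage g (x (Fin.last r)) p * ∏ j, x j.castSucc (p j) := by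
  rw [expect_eq_expect_snoc]
  refine expect_congr rfl fun p _ => ?_
  rw [lastAverage, expect_mul]
  refine expect_congr rfl fun a _ => ?_
  simp only [Fin.prod_univ_castSucc, Fin.snoc_castSucc, Fin.snoc_last]
  ring

theorem expect_lastAverage_one (g : (Fin (r + 1) → Ω) → ℝ) :
    𝔼 p, lastAverage g 1 p = 𝔼 z, g z := by
  simp [expect_eq_expect_snoc g, lastAverage]

theorem lastAverage_eq_sub_const_add (g : (Fin (r + 1) → Ω) → ℝ) (x : Ω → ℝ) (c : ℝ)
    (p : Fin r → Ω) :
    lastAverage g x p = lastAverage g (fun a => x a - c) p + c * lastAverage g 1 p := by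
  simp only [lastAverage, mul_expect, ← expect_add_distrib, Pi.one_apply]
  exact expect_congr rfl fun a _ => by ring

theorem sq_boxValue_lastAverage_le (g : (Fin (r + 1) → Ω) → ℝ) {x : Ω → ℝ}
    (hx : 𝔼 a, x a ^ 2 ≤ 1) : boxValue r (lastAverage g x) ^ 2 ≤ boxValue (r + 1) g := by
  rw [boxValue_lastAverage, boxValue_succ]
  exact sq_expect_prod_mul_le hx _

/-- The Gowers–Cauchy–Schwarz inequality for the box form. -/
theorem abs_expect_mul_prod_pow_le (g : (Fin r → Ω) → ℝ) {x : Fin r → Ω → ℝ}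
    (hx : ∀ j, 𝔼 a, x j a ^ 2 ≤ 1) :
    |𝔼 z, g z * ∏ j, x j (z j)| ^ 2 ^ r ≤ |boxValue r g| := by
  induction r with
  | zero => simp [boxValue, boxForm, Matrix.empty_eq]
  | succ r ih =>
    rw [expect_mul_prod_succ, pow_succ, pow_mul]
    calc _ ≤ |boxValue r (lastAverage g (x (Fin.last r)))| ^ 2 := by
          gcongr
          exact ih _ fun j => hx j.castSucc
      _ ≤ boxValue (r + 1) g := by
          rw [sq_abs]
          exact sq_boxValue_lastAverage_le g (hx _)
      _ ≤ _ := le_abs_self _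

variable [Nonempty Ω]

theorem abs_expect_pow_le (g : (Fin r → Ω) → ℝ) : |𝔼 z, g z| ^ 2 ^ r ≤ |boxValue r g| := by
  simpa using abs_expect_mul_prod_pow_le g (x := fun _ _ => 1) fun _ => by simp

theorem sq_boxValue_lastAverage_le_sub (g : (Fin (r + 1) → Ω) → ℝ) {u : Ω → ℝ}
    (hu : 𝔼 a, u a ^ 2 ≤ 1) (hu0 : 𝔼 a, u a = 0) :
    boxValue r (lastAverage g u) ^ 2 ≤
      boxValue (r + 1) g - boxValue r (lastAverage g 1) ^ 2 := by
  have hmean : boxValue r (lastAverage g 1) = 𝔼 w, boxSlice g w := by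
    simp [boxValue_lastAverage]
  have hprod : 𝔼 w : (Fin r → Bool) → Ω, ∏ s, u (w s) = 0 := by
    rw [expect_prod_comp, hu0, zero_pow Fintype.card_ne_zero]
  have hcentre : boxValue r (lastAverage g u) =
      𝔼 w, (∏ s, u (w s)) * (boxSlice g w - 𝔼 v, boxSlice g v) := by
    rw [boxValue_lastAverage]
    simp only [mul_sub, expect_sub_distrib, ← expect_mul, hprod, zero_mul, sub_zero]
  rw [hcentre, hmean, boxValue_succ, ← expect_sub_expect_sq]
  exact sq_expect_prod_mul_le hu _

theorem abs_boxValue_lastAverage_le (g : (Fin (r + 1) → Ω) → ℝ) {θ : ℝ} (hθ : 0 ≤ θ)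
    (hg : boxValue (r + 1) g ≤ |𝔼 z, g z| ^ 2 ^ (r + 1) + θ ^ 2 ^ (r + 1)) :
    |boxValue r (lastAverage g 1)| ≤ |𝔼 z, g z| ^ 2 ^ r + θ ^ 2 ^ r ∧
      ∀ u : Ω → ℝ, 𝔼 a, u a ^ 2 ≤ 1 → 𝔼 a, u a = 0 →
        |boxValue r (lastAverage g u)| ≤ θ ^ 2 ^ r := by
  have hθr : 0 ≤ θ ^ 2 ^ r := by positivity
  have hm : 0 ≤ |𝔼 z, g z| ^ 2 ^ r := by positivity
  have hlower : |𝔼 z, g z| ^ 2 ^ r ≤ |boxValue r (lastAverage g 1)| :=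
    expect_lastAverage_one g ▸ abs_expect_pow_le (lastAverage g 1)
  simp only [pow_succ 2 r, pow_mul] at hg
  constructor
  · refine abs_le_of_sq_le_sq (?_ : boxValue r (lastAverage g 1) ^ 2 ≤ _) (by positivity)
    nlinarith [sq_boxValue_lastAverage_le g (x := 1) (by simp)]
  · intro u hu hu0
    refine abs_le_of_sq_le_sq ?_ hθr
    nlinarith [sq_boxValue_lastAverage_le_sub g hu hu0,
      sq_abs (boxValue r (lastAverage g 1))]

/-- Split the last factor into its mean `c` and a part `u` of mean zero. The near-minimality of the
box value makes the contribution of `u` small, and that of `c` has one variable fewer. -/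
theorem abs_expect_mul_prod_sub_le (g : (Fin r → Ω) → ℝ) {θ : ℝ} (hθ : 0 ≤ θ)
    (hg : |boxValue r g| ≤ |𝔼 z, g z| ^ 2 ^ r + θ ^ 2 ^ r) {x : Fin r → Ω → ℝ}
    (hx : ∀ j, 𝔼 a, x j a ^ 2 ≤ 1) :
    |𝔼 z, g z * ∏ j, x j (z j) - (𝔼 z, g z) * ∏ j, 𝔼 a, x j a| ≤ r * θ := by
  induction r with
  | zero => simp
  | succ r ih =>
    set c := 𝔼 a, x (Fin.last r) a with hc
    set u : Ω → ℝ := fun a => x (Fin.last r) a - c with hu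
    obtain ⟨hbar, hzero⟩ := abs_boxValue_lastAverage_le g hθ ((le_abs_self _).trans hg)
    have hvar : 𝔼 a, u a ^ 2 = 𝔼 a, x (Fin.last r) a ^ 2 - c ^ 2 := expect_sub_expect_sq _
    have hu1 : 𝔼 a, u a ^ 2 ≤ 1 := by linarith [hx (Fin.last r), sq_nonneg c]
    have hu0 : 𝔼 a, u a = 0 := by simp [hu, expect_sub_distrib, hc]
    have hc1 : |c| ≤ 1 := by
      rw [← sq_le_one_iff_abs_le_one]
      have : 0 ≤ 𝔼 a, u a ^ 2 := expect_nonneg fun _ _ => sq_nonneg _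
      linarith [hx (Fin.last r)]
    have hperp : |𝔼 p, lastAverage g u p * ∏ j, x j.castSucc (p j)| ≤ θ :=
      le_of_pow_le_pow_left₀ (n := 2 ^ r) (by positivity) hθ
        ((abs_expect_mul_prod_pow_le _ fun j => hx j.castSucc).trans (hzero u hu1 hu0))
    have hmean := ih (lastAverage g 1) (expect_lastAverage_one g ▸ hbar) fun j => hx j.castSucc
    rw [expect_lastAverage_one] at hmean
    have hsplit := lastAverage_eq_sub_const_add g (x (Fin.last r)) c
    calc _ = |𝔼 p, lastAverage g u p * ∏ j, x j.castSucc (p j) +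
            c * (𝔼 p, lastAverage g 1 p * ∏ j, x j.castSucc (p j) -
              (𝔼 z, g z) * ∏ j : Fin r, 𝔼 a, x j.castSucc a)| := by
          rw [expect_mul_prod_succ, Fin.prod_univ_castSucc, ← hc]
          simp only [hsplit, ← hu, add_mul, mul_assoc, expect_add_distrib, ← mul_expect]
          ring_nf
      _ ≤ θ + 1 * (r * θ) := by
          refine (abs_add_le _ _).trans (add_le_add hperp ?_)
          rw [abs_mul]
          gcongr
      _ = ((r + 1 : ℕ) : ℝ) * θ := by push_cast; ring

end BoxForm

section ClosedForm

open Finset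
open scoped BigOperators

theorem expect_comp_injective {M A B V : Type*} [AddCommMonoid M] [Module ℚ≥0 M] [Fintype A]
    [Fintype B] [DecidableEq A] [DecidableEq B] [Fintype V] [Nonempty V] {e : A → B}
    (he : Function.Injective e) (f : (A → V) → M) : 𝔼 z : B → V, f (z ∘ e) = 𝔼 w, f w := by
  classical
  let E := (Equiv.piEquivPiSubtypeProd (fun b => b ∈ Set.range e) fun _ => V).trans
    (Equiv.prodCongr (Equiv.arrowCongr (Equiv.ofInjective e he).symm (Equiv.refl V))
      (Equiv.refl _))
  rw [Fintype.expect_equiv E (fun z => f (z ∘ e)) (fun q => f q.1) fun z => rfl,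
    ← univ_product_univ, expect_product]
  simp

variable {Ω : Type*} [Fintype Ω] [Nonempty Ω] {r : ℕ}

theorem boxForm_eq_expect (F : (Fin r → Bool) → (Fin r → Ω) → ℝ) :
    boxForm r F = 𝔼 z : Fin r → (Fin r → Bool) → Ω,
      ∏ s, F s fun j => z j (Function.update s j false) := by
  induction r with
  | zero => simp [boxForm, Matrix.empty_eq]
  | succ r ih =>
    have hinj : Function.Injective
        fun s : Fin r → Bool => (Fin.snoc s false : Fin (r + 1) → Bool) :=
      fun s t h => (Fin.snoc_injective2 h).1
    rw [expect_eq_expect_snoc, expect_comm, boxForm]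
    simp only [ih, prod_expect]
    rw [← expect_comp_injective hinj]
    refine expect_congr rfl fun w _ => ?_
    refine (Fintype.expect_equiv
      { toFun := fun (z : Fin r → (Fin (r + 1) → Bool) → Ω) b j s => z j (Fin.snoc s b)
        invFun := fun z j s => z (s (Fin.last r)) j (Fin.init s)
        left_inv := fun z => by simp
        right_inv := fun z => by simp } _ _ fun z => ?_).symm
    rw [← (Fin.snocEquiv fun _ : Fin (r + 1) => Bool).prod_comp, Fintype.prod_prod_type]
    refine prod_congr rfl fun b _ => prod_congr rfl fun s _ => ?_
    change F (Fin.snoc s b) _ = F (Fin.snoc s b) _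
    congr 1
    funext j
    induction j using Fin.lastCases with
    | last => simp [Fin.snocEquiv, Fin.update_snoc_last]
    | cast j => simp [Fin.snocEquiv, Fin.snoc_update]

theorem abs_boxForm_le_one {F : (Fin r → Bool) → (Fin r → Ω) → ℝ} (hF : ∀ s p, |F s p| ≤ 1) :
    |boxForm r F| ≤ 1 := by
  rw [boxForm_eq_expect]
  refine (abs_expect_le _ _).trans (expect_le univ_nonempty fun z _ => ?_)
  rw [abs_prod]
  exact prod_le_one (fun _ _ => abs_nonneg _) fun s _ => hF _ _

end ClosedForm

section CyclicTrace

variable {Y R : Type*} [Fintype Y] [DecidableEq Y] [CommSemiring R]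

theorem matrix_pow_succ_apply_eq_sum (M : Matrix Y Y R) (n : ℕ) (a b : Y) :
    (M ^ (n + 1)) a b = ∑ y : Fin n → Y, ∏ i : Fin (n + 1),
      M ((Fin.cons a y : Fin (n + 1) → Y) i) ((Fin.snoc y b : Fin (n + 1) → Y) i) := by
  induction n generalizing a with
  | zero => simp [Fin.snoc]
  | succ n ih =>
    rw [pow_succ', Matrix.mul_apply, ← (Fin.consEquiv fun _ : Fin (n + 1) => Y).sum_comp,
      Fintype.sum_prod_type]
    refine Finset.sum_congr rfl fun c _ => ?_
    rw [ih, Finset.mul_sum]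
    refine Finset.sum_congr rfl fun y _ => ?_
    rw [Fin.prod_univ_succ (n := n + 1)]
    simp only [Fin.consEquiv, Equiv.coe_fn_mk, ← Fin.cons_snoc_eq_snoc_cons, Fin.cons_zero,
      Fin.cons_succ]

theorem matrix_trace_pow_eq_sum (M : Matrix Y Y R) {N : ℕ} (hN : N ≠ 0) :
    (M ^ N).trace = ∑ y : Fin N → Y, ∏ i, M (y i) (y (finRotate N i)) := by
  obtain ⟨n, rfl⟩ := Nat.exists_eq_succ_of_ne_zero hN
  rw [← (Fin.consEquiv fun _ : Fin (n + 1) => Y).sum_comp, Fintype.sum_prod_type]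
  simp only [Matrix.trace, Matrix.diag, Nat.succ_eq_add_one, matrix_pow_succ_apply_eq_sum,
    Fin.snoc_eq_cons_rotate]
  rfl

end CyclicTrace

section Spectral

open Matrix
open scoped ComplexOrder

variable {Y 𝕜 : Type*} [Fintype Y] [DecidableEq Y] [RCLike 𝕜] {K : Matrix Y Y 𝕜}

theorem trace_pow_eq_sum_eigenvalues_pow (hK : K.IsHermitian) (N : ℕ) :
    (K ^ N).trace = ∑ i, (hK.eigenvalues i : 𝕜) ^ N := by
  conv_lhs => rw [hK.spectral_theorem, ← map_pow, diagonal_pow]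
  rw [Unitary.conjStarAlgAut_apply, trace_mul_cycle]
  simp [trace]

theorem exists_le_eigenvalue (hK : K.IsHermitian) {a : ℝ} {v : Y → 𝕜} (hv : v ≠ 0)
    (h : a * RCLike.re (star v ⬝ᵥ v) ≤ RCLike.re (star v ⬝ᵥ (K *ᵥ v))) :
    ∃ i, a ≤ hK.eigenvalues i := by
  by_contra! hlt
  have hpos : ((a : 𝕜) • (1 : Matrix Y Y 𝕜) - K).PosDef := by
    have hconj : (a : 𝕜) • (1 : Matrix Y Y 𝕜) - K =
        hK.eigenvectorUnitary * diagonal (fun i => ((a - hK.eigenvalues i : ℝ) : 𝕜)) *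
          star (hK.eigenvectorUnitary : Matrix Y Y 𝕜) := by
      conv_lhs => rw [hK.spectral_theorem, Unitary.conjStarAlgAut_apply]
      have hdiag : diagonal (fun i => ((a - hK.eigenvalues i : ℝ) : 𝕜)) =
          (a : 𝕜) • (1 : Matrix Y Y 𝕜) - diagonal (RCLike.ofReal ∘ hK.eigenvalues) := by
        rw [smul_one_eq_diagonal, diagonal_sub]
        simp
      rw [hdiag, mul_sub, sub_mul]
      simp
    rw [hconj, Unitary.isUnit_coe.posDef_star_right_conjugate_iff]
    exact posDef_diagonal_iff.mpr fun i => RCLike.ofReal_pos.mpr (sub_pos.mpr (hlt i))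
  have := hpos.re_dotProduct_pos hv
  rw [sub_mulVec, dotProduct_sub, smul_mulVec, one_mulVec, dotProduct_smul, smul_eq_mul, map_sub,
    RCLike.re_ofReal_mul] at this
  linarith

theorem pow_le_trace_pow {K : Matrix Y Y ℝ} (hK : K.PosSemidef) {a : ℝ} (ha : 0 ≤ a) {v : Y → ℝ}
    (hv : v ≠ 0) (h : a * (v ⬝ᵥ v) ≤ v ⬝ᵥ (K *ᵥ v)) (N : ℕ) : a ^ N ≤ (K ^ N).trace := by
  obtain ⟨i, hi⟩ := exists_le_eigenvalue hK.1 hv (by simpa using h)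
  rw [trace_pow_eq_sum_eigenvalues_pow hK.1]
  exact (pow_le_pow_left₀ ha hi N).trans
    (Finset.single_le_sum (f := fun j => hK.1.eigenvalues j ^ N)
      (fun j _ => pow_nonneg (hK.eigenvalues_nonneg j) _) (Finset.mem_univ i))

theorem sum_sq_le_of_sum_pow_le {ι : Type*} [Fintype ι] {μ : ι → ℝ}
    (hμ : ∀ j, 0 ≤ μ j) (hsum : ∑ j, μ j ≤ 1) {a θ : ℝ} (ha : 0 ≤ a) (hθ : 0 ≤ θ) {N : ℕ}
    (hN : N ≠ 0) {i : ι} (hi : a ≤ μ i) (hpow : ∑ j, μ j ^ N ≤ a ^ N + θ ^ N) :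
    ∑ j, μ j ^ 2 ≤ (a + θ) ^ 2 + θ := by
  classical
  rw [← Finset.add_sum_erase _ _ (Finset.mem_univ i)] at hpow hsum ⊢
  have hrest : 0 ≤ ∑ j ∈ Finset.univ.erase i, μ j ^ N :=
    Finset.sum_nonneg fun j _ => pow_nonneg (hμ j) _
  have hiN : a ^ N ≤ μ i ^ N := pow_le_pow_left₀ ha hi _
  have htop : μ i ≤ a + θ :=
    le_of_pow_le_pow_left₀ hN (by positivity) (by linarith [pow_add_pow_le ha hθ hN])
  have hsmall (j) (hj : j ∈ Finset.univ.erase i) : μ j ≤ θ :=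
    le_of_pow_le_pow_left₀ hN hθ (by
      linarith [Finset.single_le_sum (f := fun j => μ j ^ N) (fun j _ => pow_nonneg (hμ j) _) hj])
  have hsq : ∑ j ∈ Finset.univ.erase i, μ j ^ 2 ≤ θ * ∑ j ∈ Finset.univ.erase i, μ j := by
    rw [Finset.mul_sum]
    refine Finset.sum_le_sum fun j hj => ?_
    rw [sq]
    exact mul_le_mul_of_nonneg_right (hsmall j hj) (hμ j)
  have hrest_le : ∑ j ∈ Finset.univ.erase i, μ j ≤ 1 := by linarith [hμ i]
  nlinarith [pow_le_pow_left₀ (hμ i) htop 2, mul_le_mul_of_nonneg_left hrest_le hθ]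

theorem trace_sq_le_of_trace_pow_le {K : Matrix Y Y ℝ} (hK : K.PosSemidef) (htr : K.trace ≤ 1)
    {a θ : ℝ} (ha : 0 ≤ a) (hθ : 0 ≤ θ) {v : Y → ℝ} (hv : v ≠ 0)
    (h : a * (v ⬝ᵥ v) ≤ v ⬝ᵥ (K *ᵥ v)) {N : ℕ} (hN : N ≠ 0)
    (hp : (K ^ N).trace ≤ a ^ N + θ ^ N) : (K ^ 2).trace ≤ (a + θ) ^ 2 + θ := by
  obtain ⟨i, hi⟩ := exists_le_eigenvalue hK.1 hv (by simpa using h)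
  rw [trace_pow_eq_sum_eigenvalues_pow hK.1] at hp ⊢
  rw [hK.1.trace_eq_sum_eigenvalues] at htr
  exact sum_sq_le_of_sum_pow_le hK.eigenvalues_nonneg htr ha hθ hN hi hp

end Spectral

section StepKernel

open Finset Matrix
open scoped BigOperators

variable {Ω : Type*} [Fintype Ω] {m : ℕ}

/-- The step kernel of a function `g` of `m + 2` blocks. Its entry at `(y, y')` is the normalised
average of the product of `g` over the edges of a step, with the two attach tuples fixed to be `y`
(codes ending in `0`) and `y'` (codes ending in `1`); the last block is the attach block. -/
noncomputable def stepKernel (g : (Fin (m + 2) → Ω) → ℝ) :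
    Matrix ((Fin m → Bool) → Ω) ((Fin m → Bool) → Ω) ℝ :=
  .of fun y y' => boxSlice g (fun s => (bif s (Fin.last m) then y' else y) (Fin.init s)) /
    Fintype.card ((Fin m → Bool) → Ω)

/-- Half of a step: the average over the edges whose last two blocks are `w` and `y`. Doubling the
next to last variable turns it into the step kernel. -/
noncomputable def halfStep (g : (Fin (m + 2) → Ω) → ℝ) :
    Matrix ((Fin m → Bool) → Ω) ((Fin m → Bool) → Ω) ℝ :=
  .of fun y w => boxForm m fun s p => g (Fin.snoc (Fin.snoc p (w s) : Fin (m + 1) → Ω) (y s))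

variable (g : (Fin (m + 2) → Ω) → ℝ)

theorem stepKernel_apply (y y' : (Fin m → Bool) → Ω) :
    stepKernel g y y' =
      (𝔼 w, halfStep g y w * halfStep g y' w) / Fintype.card ((Fin m → Bool) → Ω) := by
  simp [stepKernel, boxSlice, boxForm, halfStep, mul_comm]

theorem stepKernel_eq_smul_mul_conjTranspose :
    stepKernel g = ((Fintype.card ((Fin m → Bool) → Ω) : ℝ) ^ 2)⁻¹ •
      (halfStep g * (halfStep g)ᴴ) := by
  ext y y'
  rw [stepKernel_apply, Fintype.expect_eq_sum_div_card, div_div, ← sq, div_eq_inv_mul]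
  simp [mul_apply]

theorem stepKernel_posSemidef : (stepKernel g).PosSemidef := by
  rw [stepKernel_eq_smul_mul_conjTranspose]
  exact (posSemidef_self_mul_conjTranspose _).smul (by positivity)

theorem trace_stepKernel_le_one [Nonempty Ω] (hg : ∀ z, |g z| ≤ 1) : (stepKernel g).trace ≤ 1 := by
  have htrace : (stepKernel g).trace = 𝔼 y, 𝔼 w, halfStep g y w ^ 2 := by
    simp [trace, stepKernel_apply, Fintype.expect_eq_sum_div_card (ι := (Fin m → Bool) → Ω),
      Finset.sum_div, sq]
  rw [htrace]
  refine expect_le univ_nonempty fun y _ => expect_le univ_nonempty fun w _ => ?_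
  exact (sq_le_one_iff_abs_le_one _).mpr (abs_boxForm_le_one fun _ _ => hg _)

theorem boxSlice_lastAverage_one (w : (Fin m → Bool) → Ω) :
    boxSlice (lastAverage g 1) w = 𝔼 y, halfStep g y w := by
  simp only [boxSlice, lastAverage, Pi.one_apply, one_mul, boxForm_expect]
  rfl

theorem one_dotProduct_stepKernel_mulVec_one :
    (1 : ((Fin m → Bool) → Ω) → ℝ) ⬝ᵥ (stepKernel g *ᵥ 1) =
      Fintype.card ((Fin m → Bool) → Ω) * boxValue (m + 1) (lastAverage g 1) := by
  have hbox : boxValue (m + 1) (lastAverage g 1) =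
      𝔼 y, 𝔼 y', 𝔼 w, halfStep g y w * halfStep g y' w := by
    simp only [boxValue_succ, boxSlice_lastAverage_one, sq, Fintype.expect_mul_expect]
    rw [expect_comm]
    exact expect_congr rfl fun y _ => expect_comm _ _ _
  rw [hbox, Fintype.card_mul_expect]
  simp only [dotProduct, mulVec, stepKernel_apply, Pi.one_apply, mul_one, one_mul,
    Fintype.expect_eq_sum_div_card, Finset.sum_div]

theorem abs_expect_pow_mul_le_stepKernel [Nonempty Ω] :
    |𝔼 z, g z| ^ 2 ^ (m + 1) * ((1 : ((Fin m → Bool) → Ω) → ℝ) ⬝ᵥ 1) ≤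
      1 ⬝ᵥ (stepKernel g *ᵥ 1) := by
  have hnonneg : 0 ≤ boxValue (m + 1) (lastAverage g 1) := by
    rw [boxValue_succ]
    exact expect_nonneg fun _ _ => sq_nonneg _
  have hmean := abs_expect_pow_le (lastAverage g 1)
  rw [expect_lastAverage_one, abs_of_nonneg hnonneg] at hmean
  rw [one_dotProduct_stepKernel_mulVec_one, mul_comm]
  gcongr
  simp [dotProduct]

variable [DecidableEq Ω]

theorem trace_stepKernel_pow {N : ℕ} (hN : N ≠ 0) :
    (stepKernel g ^ N).trace = 𝔼 y : Fin N → (Fin m → Bool) → Ω, ∏ i,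
      boxSlice g fun s => (bif s (Fin.last m) then y (finRotate N i) else y i) (Fin.init s) := by
  simp [matrix_trace_pow_eq_sum _ hN, stepKernel, prod_div_distrib,
    Fintype.expect_eq_sum_div_card, Finset.sum_div]

theorem trace_stepKernel_sq : (stepKernel g ^ 2).trace = boxValue (m + 2) g := by
  have hsymm (y y') : stepKernel g y y' = stepKernel g y' y := by
    simp [stepKernel_apply, mul_comm]
  rw [sq, trace, boxValue_succ, expect_eq_expect_expect_cond_last]
  simp only [diag_apply, mul_apply, Fintype.expect_eq_sum_div_card, Finset.sum_div]
  refine sum_congr rfl fun y _ => sum_congr rfl fun y' _ => ?_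
  rw [hsymm y' y, ← sq, div_div, ← sq, ← div_pow]
  rfl

theorem abs_expect_pow_le_trace_stepKernel_pow [Nonempty Ω] (N : ℕ) :
    (|𝔼 z, g z| ^ 2 ^ (m + 1)) ^ N ≤ (stepKernel g ^ N).trace :=
  pow_le_trace_pow (stepKernel_posSemidef g) (by positivity) one_ne_zero
    (abs_expect_pow_mul_le_stepKernel g) N

theorem boxValue_le_of_trace_pow_le [Nonempty Ω] (hg : ∀ z, |g z| ≤ 1) {N : ℕ} (hN : N ≠ 0)
    {θ : ℝ} (hθ : 0 ≤ θ)
    (h : (stepKernel g ^ N).trace ≤ (|𝔼 z, g z| ^ 2 ^ (m + 1)) ^ N + θ ^ N) :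
    boxValue (m + 2) g ≤ (|𝔼 z, g z| ^ 2 ^ (m + 1) + θ) ^ 2 + θ := by
  rw [← trace_stepKernel_sq]
  exact trace_sq_le_of_trace_pow_le (stepKernel_posSemidef g) (trace_stepKernel_le_one g hg)
    (by positivity) hθ one_ne_zero (abs_expect_pow_mul_le_stepKernel g) hN h

end StepKernel

section CyclePlace

open Finset
open scoped BigOperators

/-- `T` as a function of the blocks of its argument. Every block is padded to a full tuple in
`Fin k → V`, of which only the places `q` with `blk q = j` are read in the block `j`; so all blocks
range over the same type. -/
def blockLift {ι V R : Type*} {k : ℕ} (blk : Fin k → ι) (T : (Fin k → V) → R)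
    (z : ι → Fin k → V) : R :=
  T fun q => z (blk q) q

variable {k m N : ℕ}

/-- The vertex at the place `q` of the edge with code `s` in the `i`-th step of the cycle, where the
place `q` lies in the block `blk q` and the last block is the one of the attach tuples. -/
def cyclePlace (blk : Fin k → Fin (m + 2)) (i : Fin N) (s : Fin (m + 1) → Bool) (q : Fin k) :
    Fin N × (Fin m → Bool) × Fin k :=
  if h : blk q = Fin.last (m + 1) then
    (if s (Fin.last m) then finRotate N i else i, Fin.init s, q)
  else (i, ((blk q).castPred h).removeNth s, q)

theorem trace_stepKernel_pow_eq_expect {Ω : Type*} [Fintype Ω] [Nonempty Ω] [DecidableEq Ω]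
    (g : (Fin (m + 2) → Ω) → ℝ) (hN : N ≠ 0) :
    (stepKernel g ^ N).trace = 𝔼 y : Fin N → (Fin m → Bool) → Ω,
      𝔼 z : Fin N → Fin (m + 1) → (Fin (m + 1) → Bool) → Ω, ∏ i, ∏ s,
        g (Fin.snoc (fun j => z i j (Function.update s j false))
          ((bif s (Fin.last m) then y (finRotate N i) else y i) (Fin.init s))) := by
  simp only [trace_stepKernel_pow _ hN, boxSlice, boxForm_eq_expect, prod_expect]

/-- The vertices of the cycle among the independent variables of `trace_stepKernel_pow_eq_expect`,
where `y i u` has the places `inl (i, u, q)` and `z i j s` has the places `inr (i, j, s, q)`. -/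
def cycleCopy (blk : Fin k → Fin (m + 2)) (v : Fin N × (Fin m → Bool) × Fin k) :
    (Fin N × (Fin m → Bool) × Fin k) ⊕ (Fin N × Fin (m + 1) × (Fin (m + 1) → Bool) × Fin k) :=
  if h : blk v.2.2 = Fin.last (m + 1) then .inl v
  else .inr (v.1, (blk v.2.2).castPred h, ((blk v.2.2).castPred h).insertNth false v.2.1, v.2.2)

theorem cycleCopy_injective (blk : Fin k → Fin (m + 2)) :
    Function.Injective (cycleCopy (N := N) blk) := by
  rintro ⟨i, u, q⟩ ⟨i', u', q'⟩ h
  simp only [cycleCopy] at h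
  split_ifs at h with h1 h2
  · exact Sum.inl_injective h
  · simp only [Sum.inr.injEq, Prod.mk.injEq] at h
    obtain ⟨rfl, -, h3, rfl⟩ := h
    rw [Fin.insertNth_right_injective _ h3]

set_option synthInstance.maxSize 1000 in
theorem trace_stepKernel_pow_blockLift {V : Type*} [Fintype V] [Nonempty V] [DecidableEq V]
    (blk : Fin k → Fin (m + 2)) (T : (Fin k → V) → ℝ) (hN : N ≠ 0) :
    (stepKernel (blockLift blk T) ^ N).trace =
      𝔼 f : Fin N × (Fin m → Bool) × Fin k → V, ∏ i, ∏ s, T (f ∘ cyclePlace blk i s) := by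
  rw [trace_stepKernel_pow_eq_expect _ hN, ← expect_comp_injective (cycleCopy_injective blk),
    ← expect_product' univ univ, univ_product_univ]
  refine (Fintype.expect_equiv
    { toFun := fun F => (fun i u q => F (.inl (i, u, q)), fun i j s q => F (.inr (i, j, s, q)))
      invFun := fun F => Sum.elim (fun v => F.1 v.1 v.2.1 v.2.2)
        fun v => F.2 v.1 v.2.1 v.2.2.1 v.2.2.2
      left_inv := fun F => by funext b; rcases b with b | b <;> rfl
      right_inv := fun F => rfl } _ _ fun F => ?_).symm
  refine prod_congr rfl fun i _ => prod_congr rfl fun s _ => congrArg T (funext fun q => ?_)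
  by_cases h : blk q = Fin.last (m + 1)
  · cases hs : s (Fin.last m) <;> (simp [cyclePlace, cycleCopy, h, hs]; rfl)
  · obtain ⟨j, hj⟩ := Fin.exists_castSucc_eq.mpr h
    simp [cyclePlace, cycleCopy, ← hj]
    rfl

end CyclePlace

section PlacePermutation

theorem exists_equiv_of_map_univ_eq {α β γ : Type*} [Fintype α] [Fintype β] {f : α → γ}
    {g : β → γ} (h : Finset.univ.val.map f = Finset.univ.val.map g) :
    ∃ e : α ≃ β, ∀ a, g (e a) = f a := by
  classical
  have hfiber (c : γ) : Nonempty ({a // f a = c} ≃ {b // g b = c}) := by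
    have hcount := congrArg (Multiset.count c) h
    simp only [Multiset.count_map] at hcount
    rw [← Fintype.card_eq, Fintype.card_subtype, Fintype.card_subtype]
    simpa only [Finset.card, Finset.filter_val, eq_comm] using hcount
  exact ⟨.ofFiberEquiv fun c => (hfiber c).some, Equiv.ofFiberEquiv_map _⟩

variable {U V : Type*} {k : ℕ}

theorem exists_perm_of_symOfFn_eq {f g : Fin k → V} (h : symOfFn f = symOfFn g) :
    ∃ σ : Equiv.Perm (Fin k), g ∘ σ = f :=
  (exists_equiv_of_map_univ_eq (f := f) (g := g) (congrArg Subtype.val h)).imp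
    fun _ hσ => funext hσ

theorem symOfFn_comp_perm (f : Fin k → V) (σ : Equiv.Perm (Fin k)) :
    symOfFn (f ∘ σ) = symOfFn f := by
  refine Subtype.ext ?_
  change Multiset.map (f ∘ σ) Finset.univ.val = Multiset.map f Finset.univ.val
  rw [← Multiset.map_map, Multiset.map_univ_val_equiv]

theorem map_symOfFn (g : U → V) (f : Fin k → U) : Sym.map g (symOfFn f) = symOfFn (g ∘ f) :=
  Subtype.ext (Multiset.map_map g f Finset.univ.val)

theorem exists_perm_of_ofComposition_eq {c d : Composition k}
    (h : Nat.Partition.ofComposition k c = Nat.Partition.ofComposition k d) :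
    ∃ (β : Fin d.length ≃ Fin c.length) (ρ : Equiv.Perm (Fin k)),
      ∀ q, c.index (ρ q) = β (d.index q) := by
  have hmap (a : Composition k) : Finset.univ.val.map a.blocksFun = (a.blocks : Multiset ℕ) := by
    rw [← a.ofFn_blocksFun, Fin.univ_val_map]
  have hblocks : (d.blocks : Multiset ℕ) = c.blocks := congrArg Nat.Partition.parts h.symm
  obtain ⟨β, hβ⟩ := exists_equiv_of_map_univ_eq (f := d.blocksFun) (g := c.blocksFun)
    (by rw [hmap, hmap, hblocks])
  refine ⟨β, d.blocksFinEquiv.symm.trans ((Equiv.sigmaCongr β fun i =>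
    finCongr (hβ i).symm).trans c.blocksFinEquiv), fun q => ?_⟩
  obtain ⟨⟨i, r⟩, rfl⟩ := d.blocksFinEquiv.surjective q
  simp only [Equiv.trans_apply, Equiv.symm_apply_apply]
  exact (c.index_embedding (β i) _).trans (congrArg β (d.index_embedding i r).symm)

end PlacePermutation

namespace LoopHypergraph

open Finset
open scoped BigOperators

section Density

variable {I U V : Type*} {k : ℕ}

open Classical in
/-- The indicator function of the ordered edges of `H`: the tuples whose multiset of entries is an
edge. -/
noncomputable def edgeIndicator (H : LoopHypergraph V k) (v : Fin k → V) : ℝ :=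
  if symOfFn v ∈ H.edges then 1 else 0

open Classical in
/-- The hypergraph whose edges are listed by `a`, where `a i q` is the vertex at the place `q` of
the `i`-th edge. -/
noncomputable def ofPlaces [Fintype I] (a : I → Fin k → U) : LoopHypergraph U k where
  edges := univ.image fun i => symOfFn (a i)

/-- A map of vertex sets is a homomorphism if it maps edges to edges; it need not be injective. -/
def IsHom (F : LoopHypergraph U k) (H : LoopHypergraph V k) (f : U → V) : Prop :=
  ∀ e ∈ F.edges, Sym.map f e ∈ H.edges

open Classical in
/-- The probability that a uniformly random map `U → V` is a homomorphism from `F` to `H`. -/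
noncomputable def homDensity [Fintype U] [DecidableEq U] [Fintype V] (F : LoopHypergraph U k)
    (H : LoopHypergraph V k) : ℝ :=
  𝔼 f : U → V, if F.IsHom H f then 1 else 0

/-- The probability that a uniformly random `k`-tuple of vertices is an ordered edge of `H`. -/
noncomputable def edgeDensity [Fintype V] (H : LoopHypergraph V k) : ℝ := 𝔼 v, H.edgeIndicator v

theorem edgeIndicator_nonneg (H : LoopHypergraph V k) (v : Fin k → V) : 0 ≤ H.edgeIndicator v := by
  unfold edgeIndicator
  split_ifs <;> norm_num

theorem edgeIndicator_le_one (H : LoopHypergraph V k) (v : Fin k → V) :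
    H.edgeIndicator v ≤ 1 := by
  unfold edgeIndicator
  split_ifs <;> norm_num

theorem edgeIndicator_comp_perm (H : LoopHypergraph V k) (v : Fin k → V)
    (σ : Equiv.Perm (Fin k)) : H.edgeIndicator (v ∘ σ) = H.edgeIndicator v := by
  rw [edgeIndicator, edgeIndicator, symOfFn_comp_perm]

theorem isHom_ofPlaces [Fintype I] {a : I → Fin k → U} {H : LoopHypergraph V k} {f : U → V} :
    (ofPlaces a).IsHom H f ↔ ∀ i, symOfFn (f ∘ a i) ∈ H.edges := by
  simp [IsHom, ofPlaces, map_symOfFn]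

theorem homDensity_ofPlaces [Fintype I] [Fintype U] [DecidableEq U] [Fintype V] (a : I → Fin k → U)
    (H : LoopHypergraph V k) :
    (ofPlaces a).homDensity H = 𝔼 f : U → V, ∏ i, H.edgeIndicator (f ∘ a i) := by
  classical
  simp only [homDensity, isHom_ofPlaces, edgeIndicator, prod_boole, mem_univ, true_imp_iff]

theorem card_edges_ofPlaces [Fintype I] {a : I → Fin k → U}
    (ha : Function.Injective fun i => symOfFn (a i)) :
    (ofPlaces a).edges.card = Fintype.card I := by
  classical
  rw [ofPlaces, card_image_of_injective _ ha, card_univ]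

theorem edgeDensity_nonneg [Fintype V] (H : LoopHypergraph V k) : 0 ≤ H.edgeDensity :=
  expect_nonneg fun v _ => H.edgeIndicator_nonneg v

theorem edgeDensity_le_one [Fintype V] [Nonempty V] (H : LoopHypergraph V k) :
    H.edgeDensity ≤ 1 :=
  expect_le univ_nonempty fun v _ => H.edgeIndicator_le_one v

variable [Fintype U] [DecidableEq U] [Fintype V]

open Classical in
theorem expect_injective_and_isHom (F : LoopHypergraph U k) (H : LoopHypergraph V k) :
    (𝔼 f : U → V, if Function.Injective f ∧ F.IsHom H f then (1 : ℝ) else 0) =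
      F.labeledCopies H / (Fintype.card V : ℝ) ^ Fintype.card U := by
  rw [Fintype.expect_eq_sum_div_card, Finset.sum_boole, Fintype.card_fun, labeledCopies,
    ← Fintype.card_subtype, Nat.card_eq_fintype_card, Nat.cast_pow]
  congr 2
  exact Fintype.card_congr
    { toFun := fun f => ⟨⟨f.1, f.2.1⟩, f.2.2⟩
      invFun := fun f => ⟨f.1, f.1.injective, f.2⟩ }

open Classical in
theorem expect_injective :
    (𝔼 f : U → V, if Function.Injective f then (1 : ℝ) else 0) =
      (Fintype.card V).descFactorial (Fintype.card U) /
        (Fintype.card V : ℝ) ^ Fintype.card U := by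
  rw [Fintype.expect_eq_sum_div_card, Finset.sum_boole, Fintype.card_fun, Nat.cast_pow,
    ← Fintype.card_subtype, Fintype.card_congr (Equiv.subtypeInjectiveEquivEmbedding U V),
    Fintype.card_embedding_eq]

theorem homDensity_le [Nonempty V] (F : LoopHypergraph U k) (H : LoopHypergraph V k) :
    F.homDensity H ≤ F.labeledCopies H / (Fintype.card V : ℝ) ^ Fintype.card U +
      (1 - (Fintype.card V).descFactorial (Fintype.card U) /
        (Fintype.card V : ℝ) ^ Fintype.card U) := by
  classical
  rw [← expect_injective_and_isHom, ← expect_injective, ← Fintype.expect_const (ι := U → V) (1 : ℝ),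
    ← expect_sub_distrib, ← expect_add_distrib]
  refine expect_le_expect fun f _ => ?_
  by_cases hinj : Function.Injective f <;> by_cases hhom : F.IsHom H f <;> simp [hinj, hhom]

end Density

section EdgeCount

variable {V : Type*} [Fintype V] {k : ℕ}

open Classical in
theorem card_symOfFn_fiber_le (e : Sym V k) :
    #{v : Fin k → V | symOfFn v = e} ≤ k.factorial := by
  obtain h | ⟨v₀, hv₀⟩ := (univ.filter fun v : Fin k → V => symOfFn v = e).eq_empty_or_nonempty
  · simp [h]
  calc _ ≤ #(univ.image fun σ : Equiv.Perm (Fin k) => v₀ ∘ σ) := by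
        refine card_le_card fun v hv => ?_
        simp only [mem_filter, mem_univ, true_and] at hv hv₀
        simpa using exists_perm_of_symOfFn_eq (hv.trans hv₀.symm)
    _ ≤ _ := card_image_le
    _ = _ := by rw [card_univ, Fintype.card_perm, Fintype.card_fin]

open Classical in
theorem sum_edgeIndicator (H : LoopHypergraph V k) :
    ∑ v, H.edgeIndicator v = ∑ e ∈ H.edges, (#{v : Fin k → V | symOfFn v = e} : ℝ) := by
  simp only [edgeIndicator, Finset.sum_boole]
  rw [← Nat.cast_sum, Nat.cast_inj, card_eq_sum_card_fiberwise (f := symOfFn) (t := H.edges)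
    fun v hv => by simpa using hv]
  refine sum_congr rfl fun e he => congrArg card ?_
  ext v
  simp only [mem_filter, mem_univ, true_and, and_iff_right_iff_imp]
  rintro rfl
  exact he

theorem abs_factorial_mul_card_edges_sub_sum_edgeIndicator_le (H : LoopHypergraph V k) :
    |(k.factorial * H.edges.card : ℝ) - ∑ v, H.edgeIndicator v| ≤
      (Fintype.card V).ascFactorial k - (Fintype.card V : ℝ) ^ k := by
  classical
  set fiber : Sym V k → ℝ := fun e => #{v : Fin k → V | symOfFn v = e}
  have hnonneg (e) : 0 ≤ (k.factorial : ℝ) - fiber e :=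
    sub_nonneg.mpr (Nat.cast_le.mpr (card_symOfFn_fiber_le e))
  have hedges : (k.factorial * H.edges.card : ℝ) - ∑ v, H.edgeIndicator v =
      ∑ e ∈ H.edges, ((k.factorial : ℝ) - fiber e) := by
    rw [sum_edgeIndicator, sum_sub_distrib, sum_const, nsmul_eq_mul, mul_comm]
  have hall : ∑ e, fiber e = (Fintype.card V : ℝ) ^ k := by
    rw [← sum_edgeIndicator (⟨univ⟩ : LoopHypergraph V k)]
    simp [edgeIndicator]
  rw [hedges, abs_of_nonneg (sum_nonneg fun e _ => hnonneg e)]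
  refine (sum_le_univ_sum_of_nonneg hnonneg).trans_eq ?_
  rw [sum_sub_distrib, hall, sum_const, card_univ, Sym.card_sym_eq_choose, nsmul_eq_mul,
    Nat.ascFactorial_eq_factorial_mul_choose', mul_comm, Nat.cast_mul]

theorem abs_factorial_mul_card_edges_div_sub_edgeDensity_le [Nonempty V]
    (H : LoopHypergraph V k) :
    |(k.factorial * H.edges.card : ℝ) / (Fintype.card V : ℝ) ^ k - H.edgeDensity| ≤
      (Fintype.card V).ascFactorial k / (Fintype.card V : ℝ) ^ k - 1 := by
  have hpos : 0 < (Fintype.card V : ℝ) ^ k := by positivity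
  rw [edgeDensity, Fintype.expect_eq_sum_div_card, Fintype.card_fun, Fintype.card_fin,
    Nat.cast_pow, ← sub_div, abs_div, abs_of_pos hpos, ← div_self hpos.ne', ← sub_div]
  gcongr
  exact H.abs_factorial_mul_card_edges_sub_sum_edgeIndicator_le

end EdgeCount

end LoopHypergraph

section CycleCodes

theorem removeBit_comp_cast {t m : ℕ} (h : t = m + 2) (s : Fin (m + 1) → Bool) (j : Fin (m + 1)) :
    removeBit (t := t) (s ∘ Fin.cast (by omega)) j = j.removeNth s ∘ Fin.cast (by omega) := by
  subst h
  funext i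
  refine congrArg s (Fin.ext ?_)
  change (if (i : ℕ) < j then (i : ℕ) else i + 1) = (j.succAbove (i : Fin m) : ℕ)
  simp only [Fin.succAbove, Fin.lt_def, Fin.val_castSucc]
  split_ifs <;> simp

theorem lastBit_comp_cast {t m : ℕ} (h : t = m + 2) (s : Fin (m + 1) → Bool) :
    lastBit (t := t) (s ∘ Fin.cast (by omega)) = s (Fin.last m) := by
  subst h
  exact dif_pos (by omega)

variable {k m N : ℕ} {c : Composition k}

/-- The renumbering of the blocks of `c` which moves the first block, that of the attach tuples, to
the end, where `cyclePlace` expects it, and shifts the others down by one. -/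
def attachLast (h : c.length = m + 2) : Fin c.length ≃ Fin (m + 2) :=
  (finCongr h).trans (finRotate (m + 2)).symm

theorem attachLast_of_eq_zero (h : c.length = m + 2) {j : Fin c.length} (hj : (j : ℕ) = 0) :
    attachLast h j = Fin.last (m + 1) := by
  rw [attachLast, Equiv.trans_apply, Equiv.symm_apply_eq, finRotate_last]
  exact Fin.ext hj

theorem attachLast_of_ne_zero (h : c.length = m + 2) {j : Fin c.length} (hj : (j : ℕ) ≠ 0) :
    attachLast h j = Fin.castSucc ⟨j - 1, by omega⟩ := by
  rw [attachLast, Equiv.trans_apply, Equiv.symm_apply_eq]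
  refine Fin.ext ?_
  rw [finRotate_of_lt (by simp; omega)]
  simp
  omega

/-- The vertices of the cycle with codes of length `m` in place of `c.length - 2`. -/
def cycleVertexEquiv (h : c.length = m + 2) (N : ℕ) :
    Fin N × (Fin m → Bool) × Fin k ≃ CycleVertex c N :=
  (Equiv.refl _).prodCongr (((finCongr (by omega)).arrowCongr (Equiv.refl _)).prodCongr
    (Equiv.refl _))

theorem glueStep_comp_stepPlace (h : c.length = m + 2) (i : Fin N) (s : Fin (m + 1) → Bool) :
    glueStep c N i ∘ stepPlace c (s ∘ Fin.cast (by omega)) =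
      cycleVertexEquiv h N ∘ cyclePlace (attachLast h ∘ c.index) i s := by
  funext q
  by_cases hq : (c.index q : ℕ) = 0
  · have hbit : removeBit (t := c.length) (s ∘ Fin.cast (by omega)) (c.length - 2) =
        Fin.init s ∘ Fin.cast (by omega) := by
      rw [← Fin.removeNth_last, ← removeBit_comp_cast h]
      exact congrArg (removeBit _) (Nat.sub_eq_of_eq_add h)
    simp only [Function.comp_apply, stepPlace, hq, dite_true, glueStep, lastBit_comp_cast h, hbit,
      cyclePlace, attachLast_of_eq_zero h hq]
    rfl
  · have hbit := removeBit_comp_cast h s ⟨c.index q - 1, by omega⟩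
    simp only [Function.comp_apply, stepPlace, hq, dite_false, glueStep, cyclePlace, hbit,
      attachLast_of_ne_zero h hq, (Fin.castSucc_lt_last _).ne, Fin.castPred_castSucc]
    rfl

theorem cycleHypergraph_eq_ofPlaces (h : c.length = m + 2) (N : ℕ) :
    cycleHypergraph c N = .ofPlaces fun v : Fin N × (Fin (m + 1) → Bool) =>
      cycleVertexEquiv h N ∘ cyclePlace (attachLast h ∘ c.index) v.1 v.2 := by
  have hcodes : Function.Surjective fun s : Fin (m + 1) → Bool =>
      (s ∘ Fin.cast (by omega) : Fin (c.length - 1) → Bool) :=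
    ((finCongr (by omega)).arrowCongr (Equiv.refl Bool)).surjective
  refine congrArg LoopHypergraph.mk (Finset.ext fun e => ?_)
  simp only [stepHypergraph, Finset.mem_biUnion, Finset.mem_image, Finset.mem_univ, true_and,
    exists_exists_eq_and, map_symOfFn, hcodes.exists, glueStep_comp_stepPlace h, Prod.exists]

theorem cyclePlace_snd_snd (blk : Fin k → Fin (m + 2)) (i : Fin N) (s : Fin (m + 1) → Bool)
    (q : Fin k) : (cyclePlace blk i s q).2.2 = q := by
  unfold cyclePlace
  split_ifs <;> rfl

theorem symOfFn_injOn {U : Type*} {place : U → Fin k} :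
    Set.InjOn symOfFn {f : Fin k → U | ∀ q, place (f q) = q} := by
  intro f hf g hg h
  obtain ⟨σ, hσ⟩ := exists_perm_of_symOfFn_eq h
  funext q
  have hσq : σ q = q := (hg (σ q)).symm.trans ((congrArg place (congrFun hσ q)).trans (hf q))
  rw [← hσ, Function.comp_apply, hσq]

theorem cyclePlace_injective {blk : Fin k → Fin (m + 2)} (hblk : Function.Surjective blk)
    (hN : 2 ≤ N) : Function.Injective fun v : Fin N × (Fin (m + 1) → Bool) =>
      cyclePlace blk v.1 v.2 := by
  rintro ⟨i, s⟩ ⟨i', s'⟩ h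
  obtain ⟨q, hq⟩ := hblk (Fin.castSucc 0)
  obtain ⟨q', hq'⟩ := hblk (Fin.last (m + 1))
  have hother := congrFun h q
  have hattach := congrFun h q'
  simp only [cyclePlace, hq, hq', dif_pos, (Fin.castSucc_lt_last _).ne, dif_neg,
    not_false_eq_true, Prod.mk.injEq, and_true] at hother hattach
  obtain ⟨rfl, -⟩ := hother
  have hrot : finRotate N i ≠ i := by
    obtain ⟨n, rfl⟩ : ∃ n, N = n + 2 := ⟨N - 2, by omega⟩
    rw [finRotate_apply]
    simp
  have hlast : s (Fin.last m) = s' (Fin.last m) := by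
    cases hs : s (Fin.last m) <;> cases hs' : s' (Fin.last m) <;>
      simp only [hs, hs', if_true, Bool.false_eq_true, if_false] at hattach ⊢
    · exact absurd hattach.1.symm hrot
    · exact absurd hattach.1 hrot
  rw [Prod.mk.injEq, ← Fin.snoc_init_self s, ← Fin.snoc_init_self s', hattach.2, hlast]
  exact ⟨rfl, rfl⟩

end CycleCodes

section CycleDensity

open Finset
open scoped BigOperators

variable {k m N : ℕ} {c : Composition k}

theorem card_edges_cycleHypergraph (h : c.length = m + 2) (hN : 2 ≤ N) :
    (cycleHypergraph c N).edges.card = 2 ^ (m + 1) * N := by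
  have hindex : Function.Surjective (attachLast h ∘ c.index) :=
    (attachLast h).surjective.comp fun i =>
      ⟨c.embedding i ⟨0, c.blocks_pos' i i.2⟩, c.index_embedding i _⟩
  rw [cycleHypergraph_eq_ofPlaces h, LoopHypergraph.card_edges_ofPlaces]
  · simp [mul_comm]
  refine fun v v' hv => cyclePlace_injective hindex hN ?_
  refine (cycleVertexEquiv h N).injective.comp_left
    (symOfFn_injOn (place := fun u => u.2.2)
      (fun q => ?_) (fun q => ?_) hv)
  · exact cyclePlace_snd_snd (attachLast h ∘ c.index) v.1 v.2 q
  · exact cyclePlace_snd_snd (attachLast h ∘ c.index) v'.1 v'.2 q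

theorem homDensity_cycleHypergraph {V : Type*} [Fintype V] (h : c.length = m + 2) (N : ℕ)
    (H : LoopHypergraph V k) :
    (cycleHypergraph c N).homDensity H = 𝔼 f : Fin N × (Fin m → Bool) × Fin k → V,
      ∏ i, ∏ s, H.edgeIndicator (f ∘ cyclePlace (attachLast h ∘ c.index) i s) := by
  rw [cycleHypergraph_eq_ofPlaces h, LoopHypergraph.homDensity_ofPlaces]
  refine Fintype.expect_equiv (M := ℝ) ((cycleVertexEquiv h N).symm.arrowCongr (Equiv.refl V)) _ _
    fun f => ?_
  rw [Fintype.prod_prod_type]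
  rfl

end CycleDensity

section FormSpectralNorm

variable {ι : Type*} {E : ι → Type*} [∀ i, NormedAddCommGroup (E i)] [∀ i, NormedSpace ℝ (E i)]

theorem formSpectralNorm_nonneg (φ : MultilinearMap ℝ E ℝ) : 0 ≤ formSpectralNorm φ :=
  Real.sSup_nonneg (by rintro r ⟨x, -, rfl⟩; exact abs_nonneg _)

theorem formSpectralNorm_le {φ : MultilinearMap ℝ E ℝ} {b : ℝ} (hb : 0 ≤ b)
    (hφ : ∀ x, (∀ i, ‖x i‖ = 1) → |φ x| ≤ b) : formSpectralNorm φ ≤ b :=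
  Real.sSup_le (by rintro r ⟨x, hx, rfl⟩; exact hφ x hx) hb

theorem le_formSpectralNorm [Finite ι] {φ : MultilinearMap ℝ E ℝ} (hφ : Continuous φ)
    {x : ∀ i, E i} (hx : ∀ i, ‖x i‖ = 1) : |φ x| ≤ formSpectralNorm φ := by
  have := Fintype.ofFinite ι
  obtain ⟨C, -, hC⟩ := φ.exists_bound_of_continuous hφ
  refine le_csSup ⟨C, ?_⟩ ⟨x, hx, rfl⟩
  rintro r ⟨y, hy, rfl⟩
  simpa [hy] using hC y

end FormSpectralNorm

section Flatten

open Finset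
open scoped BigOperators

variable {V : Type*} [Fintype V] {k : ℕ}

theorem formOfCoeff_apply {I ι : Type*} [Fintype I] [Fintype ι] {B : ι → Type*}
    [∀ j, Fintype (B j)] (s : ∀ j, I → B j) (a : I → ℝ) (x : ∀ j, EuclideanSpace ℝ (B j)) :
    formOfCoeff s a x = ∑ v, a v * ∏ j, x j (s j v) := by
  simp [formOfCoeff]

theorem continuous_formOfCoeff {I ι : Type*} [Fintype I] [Fintype ι] {B : ι → Type*}
    [∀ j, Fintype (B j)] (s : ∀ j, I → B j) (a : I → ℝ) : Continuous (formOfCoeff s a) := by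
  rw [funext (formOfCoeff_apply s a)]
  fun_prop

/-- The `k`-linear form on `ℝ^V` whose value at `(e_{v_1}, …, e_{v_k})` is `T v`; the adjacency map
and the all-ones map are of this kind. -/
noncomputable def tensorForm (T : (Fin k → V) → ℝ) :
    MultilinearMap ℝ (fun _ : Fin k => EuclideanSpace ℝ V) ℝ :=
  formOfCoeff (fun j v => v j) T

theorem tensorForm_basisFun (T : (Fin k → V) → ℝ) (w : Fin k → V) :
    tensorForm T (fun j => EuclideanSpace.basisFun V ℝ (w j)) = T w := by
  classical
  rw [tensorForm, formOfCoeff_apply, Finset.sum_eq_single w]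
  · simp
  · intro v _ hv
    obtain ⟨j, hj⟩ := Function.ne_iff.mp hv
    rw [prod_eq_zero (mem_univ j) (by simp [hj]), mul_zero]
  · simp

variable {d : Composition k}

theorem flatten_tensorForm_apply (T : (Fin k → V) → ℝ)
    (x : ∀ i, EuclideanSpace ℝ (Fin (d.blocksFun i) → V)) :
    flatten (tensorForm T) d x = ∑ v, T v * ∏ i, x i fun r => v (d.embedding i r) := by
  simp only [flatten, formOfCoeff_apply, tensorForm_basisFun]

theorem sqrt_natCast_pow_sq (n b : ℕ) : (√(n : ℝ) ^ b) ^ 2 = (n : ℝ) ^ b := by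
  rw [← pow_mul, mul_comm, pow_mul, Real.sq_sqrt n.cast_nonneg]

variable {ι : Type*} {β : Fin d.length ≃ ι} {ρ : Equiv.Perm (Fin k)}

/-- The vector `x i`, regarded as a function of the block `j = β i` and normalised so that its mean
square is `‖x i‖ ^ 2`; the place `r` of the `i`-th block of `d` is read at the place
`ρ (d.embedding i r)`. -/
noncomputable def blockTest (β : Fin d.length ≃ ι) (ρ : Equiv.Perm (Fin k))
    (x : ∀ i, EuclideanSpace ℝ (Fin (d.blocksFun i) → V)) (j : ι) (z : Fin k → V) : ℝ :=
  √(Fintype.card V) ^ d.blocksFun (β.symm j) *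
    x (β.symm j) fun r => z (ρ (d.embedding (β.symm j) r))

variable [Nonempty V]

theorem expect_blockTest_sq (x : ∀ i, EuclideanSpace ℝ (Fin (d.blocksFun i) → V)) (j : ι) :
    𝔼 z, blockTest β ρ x j z ^ 2 = ‖x (β.symm j)‖ ^ 2 := by
  classical
  have hinj : Function.Injective fun r => ρ (d.embedding (β.symm j) r) :=
    ρ.injective.comp (d.embedding _).injective
  have hcard : (Fintype.card (Fin (d.blocksFun (β.symm j)) → V) : ℝ) =
      (√(Fintype.card V) ^ d.blocksFun (β.symm j)) ^ 2 := by
    rw [sqrt_natCast_pow_sq, Fintype.card_fun, Fintype.card_fin, Nat.cast_pow]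
  simp only [blockTest]
  refine (expect_comp_injective hinj fun w =>
    (√(Fintype.card V) ^ d.blocksFun (β.symm j) * x (β.symm j) w) ^ 2).trans ?_
  simp only [mul_pow, ← mul_expect]
  rw [EuclideanSpace.real_norm_sq_eq, ← Fintype.card_mul_expect, hcard]

theorem sqrt_card_pow_pos (b : ℕ) : 0 < √(Fintype.card V : ℝ) ^ b :=
  pow_pos (Real.sqrt_pos.mpr (Nat.cast_pos.mpr Fintype.card_pos)) b

variable [Fintype ι] [DecidableEq ι] {blk : Fin k → ι}

theorem expect_blockLift (blk : Fin k → ι) (T : (Fin k → V) → ℝ) :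
    𝔼 z, blockLift blk T z = 𝔼 v, T v := by
  classical
  have hinj : Function.Injective fun q => (blk q, q) := fun q q' h => congrArg Prod.snd h
  rw [← expect_comp_injective hinj]
  exact (Fintype.expect_equiv (Equiv.curry ι (Fin k) V) _ _ fun z => rfl).symm

theorem expect_blockLift_mul_prod_blockTest (hρ : ∀ q, blk (ρ q) = β (d.index q))
    {T : (Fin k → V) → ℝ} (hT : ∀ v, T (v ∘ ρ) = T v)
    (x : ∀ i, EuclideanSpace ℝ (Fin (d.blocksFun i) → V)) :
    𝔼 z, blockLift blk T z * ∏ j, blockTest β ρ x j (z j) =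
      flatten (tensorForm T) d x / √(Fintype.card V) ^ k := by
  have hblock (z : ι → Fin k → V) : blockLift blk T z * ∏ j, blockTest β ρ x j (z j) =
      √(Fintype.card V) ^ k *
        blockLift blk (fun v => T v * ∏ i, x i fun r => v (ρ (d.embedding i r))) z := by
    have htest (i) : blockTest β ρ x (β i) (z (β i)) = √(Fintype.card V) ^ d.blocksFun i *
        x i fun r => z (blk (ρ (d.embedding i r))) (ρ (d.embedding i r)) := by
      rw [blockTest, β.symm_apply_apply]
      simp only [hρ, d.index_embedding]
    rw [← β.prod_comp, prod_congr rfl fun i _ => htest i, prod_mul_distrib, prod_pow_eq_pow_sum,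
      d.sum_blocksFun, mul_left_comm]
    rfl
  have hperm : 𝔼 v, T v * ∏ i, x i (fun r => v (ρ (d.embedding i r))) =
      𝔼 v, T v * ∏ i, x i fun r => v (d.embedding i r) :=
    Fintype.expect_equiv (ρ.symm.arrowCongr (Equiv.refl V)) _ _ fun v => by rw [← hT v]; rfl
  rw [expect_congr rfl fun z _ => hblock z, ← mul_expect, expect_blockLift, hperm,
    flatten_tensorForm_apply, Fintype.expect_eq_sum_div_card, Fintype.card_fun, Fintype.card_fin,
    Nat.cast_pow, ← sqrt_natCast_pow_sq, sq]
  have := sqrt_card_pow_pos (V := V) k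
  field_simp

omit [DecidableEq ι] in
theorem prod_expect_blockTest (β : Fin d.length ≃ ι) (ρ : Equiv.Perm (Fin k))
    (x : ∀ i, EuclideanSpace ℝ (Fin (d.blocksFun i) → V)) :
    ∏ j, 𝔼 z, blockTest β ρ x j z = flatten (allOnesMap V k) d x / √(Fintype.card V) ^ k := by
  classical
  refine (prod_expect _).trans (Eq.trans ?_ (expect_blockLift_mul_prod_blockTest
    (blk := fun q => β (d.index (ρ.symm q))) (β := β) (ρ := ρ)
    (T := fun _ => 1) (fun q => by rw [ρ.symm_apply_apply]) (fun _ => rfl) x))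
  simp only [blockLift, one_mul]

theorem abs_flatten_allOnesMap_le (x : ∀ i, EuclideanSpace ℝ (Fin (d.blocksFun i) → V)) :
    |flatten (allOnesMap V k) d x| ≤ √(Fintype.card V) ^ k * ∏ i, ‖x i‖ := by
  have hpos := sqrt_card_pow_pos (V := V) k
  have hmean (i) : |𝔼 z, blockTest (.refl _) (.refl _) x i z| ≤ ‖x i‖ := by
    refine abs_le_of_sq_le_sq ?_ (norm_nonneg _)
    have hvar := expect_sub_expect_sq (blockTest (.refl _) (.refl _) x i)
    rw [expect_blockTest_sq] at hvar
    exact sub_nonneg.mp (hvar ▸ expect_nonneg fun _ _ => sq_nonneg _)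
  have habs : |flatten (allOnesMap V k) d x| / √(Fintype.card V) ^ k =
      ∏ i, |𝔼 z, blockTest (.refl _) (.refl _) x i z| := by
    rw [← abs_prod, prod_expect_blockTest, abs_div, abs_of_pos hpos]
  rw [← div_le_iff₀' hpos, habs]
  exact prod_le_prod (fun _ _ => abs_nonneg _) fun i _ => hmean i

end Flatten

section Discrepancy

open Finset
open scoped BigOperators

variable {V : Type*} [Fintype V] [Nonempty V] {k t : ℕ} {d : Composition k}

theorem abs_flatten_tensorForm_sub_le {blk : Fin k → Fin t} {β : Fin d.length ≃ Fin t}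
    {ρ : Equiv.Perm (Fin k)} (hρ : ∀ q, blk (ρ q) = β (d.index q)) {T : (Fin k → V) → ℝ}
    (hT : ∀ v, T (v ∘ ρ) = T v) {η : ℝ} (hη : 0 ≤ η)
    (hbox : |boxValue t (blockLift blk T)| ≤ |𝔼 v, T v| ^ 2 ^ t + η ^ 2 ^ t)
    {x : ∀ i, EuclideanSpace ℝ (Fin (d.blocksFun i) → V)} (hx : ∀ i, ‖x i‖ ≤ 1) :
    |flatten (tensorForm T) d x - (𝔼 v, T v) * flatten (allOnesMap V k) d x| ≤
      √(Fintype.card V) ^ k * (t * η) := by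
  have hpos := sqrt_card_pow_pos (V := V) k
  have hmain := abs_expect_mul_prod_sub_le (blockLift blk T) hη (by rwa [expect_blockLift])
    (x := blockTest β ρ x) fun j => by
      rw [expect_blockTest_sq]
      exact pow_le_one₀ (norm_nonneg _) (hx _)
  rw [expect_blockLift_mul_prod_blockTest hρ hT, expect_blockLift, prod_expect_blockTest,
    ← mul_div_assoc, ← sub_div, abs_div, abs_of_pos hpos, div_le_iff₀' hpos] at hmain
  exact hmain

theorem exists_unit_flatten_tensorForm_eq (T : (Fin k → V) → ℝ) (d : Composition k) :
    ∃ x : ∀ i, EuclideanSpace ℝ (Fin (d.blocksFun i) → V), (∀ i, ‖x i‖ = 1) ∧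
      flatten (tensorForm T) d x = √(Fintype.card V) ^ k * 𝔼 v, T v := by
  classical
  refine ⟨fun i => WithLp.toLp 2 fun _ => (√(Fintype.card V) ^ d.blocksFun i)⁻¹, fun i => ?_, ?_⟩
  · rw [← sq_eq_sq₀ (norm_nonneg _) zero_le_one, EuclideanSpace.real_norm_sq_eq]
    simp [sqrt_natCast_pow_sq]
  · rw [flatten_tensorForm_apply]
    simp only [prod_inv_distrib, prod_pow_eq_pow_sum, d.sum_blocksFun]
    rw [← Finset.sum_mul, ← Fintype.card_mul_expect, Fintype.card_fun, Fintype.card_fin,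
      Nat.cast_pow, ← sqrt_natCast_pow_sq]
    have := sqrt_card_pow_pos (V := V) k
    field_simp

theorem sqrt_pow_mul_edgeDensity_le_eig1 (H : LoopHypergraph V k) (d : Composition k) :
    √(Fintype.card V) ^ k * H.edgeDensity ≤ eig1 H d := by
  obtain ⟨x, hx, hxeq⟩ := exists_unit_flatten_tensorForm_eq H.edgeIndicator d
  exact hxeq.symm.trans_le ((le_abs_self _).trans
    (le_formSpectralNorm (φ := flatten (adjacencyMap H) d) (continuous_formOfCoeff _ _) hx))

variable {H : LoopHypergraph V k} {δ : ℝ} (hδ : 0 ≤ δ)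
  (hdisc : ∀ x, (∀ i, ‖x i‖ = 1) → |flatten (adjacencyMap H) d x -
    H.edgeDensity * flatten (allOnesMap V k) d x| ≤ δ)
include hδ hdisc

theorem abs_eig1_sub_le : |eig1 H d - √(Fintype.card V) ^ k * H.edgeDensity| ≤ δ := by
  have hlow := sqrt_pow_mul_edgeDensity_le_eig1 H d
  have hμ := H.edgeDensity_nonneg
  rw [abs_of_nonneg (sub_nonneg.mpr hlow), sub_le_iff_le_add]
  refine formSpectralNorm_le (by positivity) fun x hx => ?_
  have hones := abs_flatten_allOnesMap_le x
  simp only [hx, prod_const_one, mul_one] at hones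
  calc |flatten (adjacencyMap H) d x|
      ≤ |flatten (adjacencyMap H) d x - H.edgeDensity * flatten (allOnesMap V k) d x| +
          |H.edgeDensity * flatten (allOnesMap V k) d x| := by
        rw [← sub_le_iff_le_add]
        exact abs_sub_abs_le_abs_sub _ _
    _ ≤ δ + √(Fintype.card V) ^ k * H.edgeDensity := by
        rw [abs_mul, abs_of_nonneg hμ, mul_comm (√_ ^ k)]
        gcongr
        exact hdisc x hx

theorem abs_eig2_le : |eig2 H d| ≤ δ + √(Fintype.card V) ^ k *
    ((Fintype.card V).ascFactorial k / (Fintype.card V : ℝ) ^ k - 1) := by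
  have hcount := H.abs_factorial_mul_card_edges_div_sub_edgeDensity_le
  have hasc := (abs_nonneg _).trans hcount
  rw [eig2]
  set q : ℝ := (k.factorial * H.edges.card : ℝ) / (Fintype.card V : ℝ) ^ k
  rw [abs_of_nonneg (formSpectralNorm_nonneg _)]
  refine formSpectralNorm_le (by positivity) fun x hx => ?_
  have hones := abs_flatten_allOnesMap_le x
  simp only [hx, prod_const_one, mul_one] at hones
  calc |(flatten (adjacencyMap H) d - q • flatten (allOnesMap V k) d) x|
      = |(flatten (adjacencyMap H) d x - H.edgeDensity * flatten (allOnesMap V k) d x) -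
          flatten (allOnesMap V k) d x * (q - H.edgeDensity)| := by
        rw [sub_apply, smul_apply, smul_eq_mul]
        ring_nf
    _ ≤ _ := (abs_sub _ _).trans (add_le_add (hdisc x hx) ?_)
  rw [abs_mul]
  gcongr

end Discrepancy

section CycleDiscrepancy

open Finset Topology
open scoped BigOperators

variable {V : Type*} [Fintype V] {k m N : ℕ} {c d : Composition k}

/-- The excess of the density of the cycle of type `c` with `N` steps in `H` over the density which
it would have in a random hypergraph of the same edge density. -/
noncomputable def cycleExcess (c : Composition k) (N : ℕ) (H : LoopHypergraph V k) : ℝ :=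
  (cycleHypergraph c N).homDensity H - H.edgeDensity ^ (cycleHypergraph c N).edges.card

/-- A bound for the discrepancy of a hypergraph, relative to the number of its vertices to the power
`k / 2`, in terms of the excess `ε` of its cycles with `N` steps of a type with `t` parts. -/
noncomputable def discrepancyBound (t N : ℕ) (ε : ℝ) : ℝ :=
  t * (3 * ε ^ (N : ℝ)⁻¹ + (ε ^ (N : ℝ)⁻¹) ^ 2) ^ (((2 ^ t : ℕ) : ℝ)⁻¹)

theorem tendsto_discrepancyBound (t : ℕ) (hN : N ≠ 0) :
    Tendsto (discrepancyBound t N) (𝓝 0) (𝓝 0) := by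
  have hroot {M : ℕ} (hM : M ≠ 0) : Tendsto (fun x : ℝ => x ^ (M : ℝ)⁻¹) (𝓝 0) (𝓝 0) := by
    have hpos : (0 : ℝ) < (M : ℝ)⁻¹ := by positivity
    simpa [Real.zero_rpow hpos.ne'] using (Real.continuousAt_rpow_const 0 _ (.inr hpos.le)).tendsto
  have hsum : Tendsto (fun ε : ℝ => 3 * ε ^ (N : ℝ)⁻¹ + (ε ^ (N : ℝ)⁻¹) ^ 2) (𝓝 0) (𝓝 0) := by
    simpa using ((hroot hN).const_mul 3).add ((hroot hN).pow 2)
  have hpow := ((hroot (pow_ne_zero t two_ne_zero)).comp hsum).const_mul (t : ℝ)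
  rwa [mul_zero] at hpow

variable [Nonempty V] (H : LoopHypergraph V k)

theorem abs_expect_blockLift_edgeIndicator {ι : Type*} [Fintype ι] [DecidableEq ι]
    (blk : Fin k → ι) : |𝔼 z, blockLift blk H.edgeIndicator z| = H.edgeDensity := by
  rw [expect_blockLift]
  exact abs_of_nonneg H.edgeDensity_nonneg

theorem trace_stepKernel_pow_eq_homDensity [DecidableEq V] (h : c.length = m + 2) (hN : N ≠ 0) :
    (stepKernel (blockLift (attachLast h ∘ c.index) H.edgeIndicator) ^ N).trace =
      (cycleHypergraph c N).homDensity H := by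
  rw [trace_stepKernel_pow_blockLift _ _ hN, homDensity_cycleHypergraph h]

theorem cycleExcess_nonneg (hc : 2 ≤ c.length) (hN : 2 ≤ N) : 0 ≤ cycleExcess c N H := by
  classical
  obtain ⟨m, h⟩ := Nat.exists_eq_add_of_le' hc
  have htrace := abs_expect_pow_le_trace_stepKernel_pow
    (blockLift (attachLast h ∘ c.index) H.edgeIndicator) N
  rw [abs_expect_blockLift_edgeIndicator, ← pow_mul,
    trace_stepKernel_pow_eq_homDensity H h (by omega), ← card_edges_cycleHypergraph h hN] at htrace
  exact sub_nonneg.mpr htrace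

theorem boxValue_blockLift_edgeIndicator_le (h : c.length = m + 2) (hN : 2 ≤ N) :
    boxValue (m + 2) (blockLift (attachLast h ∘ c.index) H.edgeIndicator) ≤
      H.edgeDensity ^ 2 ^ (m + 2) +
        (3 * cycleExcess c N H ^ (N : ℝ)⁻¹ + (cycleExcess c N H ^ (N : ℝ)⁻¹) ^ 2) := by
  classical
  have hexcess : 0 ≤ cycleExcess c N H := cycleExcess_nonneg H (by omega) hN
  set θ := cycleExcess c N H ^ (N : ℝ)⁻¹ with hθ
  have hθ0 : 0 ≤ θ := Real.rpow_nonneg hexcess _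
  have hcycle : (cycleHypergraph c N).homDensity H ≤
      (H.edgeDensity ^ 2 ^ (m + 1)) ^ N + θ ^ N := by
    rw [hθ, Real.rpow_inv_natCast_pow hexcess (by omega), ← pow_mul,
      ← card_edges_cycleHypergraph h hN, cycleExcess, add_sub_cancel]
  have hbox := boxValue_le_of_trace_pow_le
    (blockLift (attachLast h ∘ c.index) H.edgeIndicator)
    (fun z => (abs_of_nonneg (H.edgeIndicator_nonneg _)).trans_le (H.edgeIndicator_le_one _))
    (by omega : N ≠ 0) hθ0
    (by rwa [abs_expect_blockLift_edgeIndicator, trace_stepKernel_pow_eq_homDensity H h (by omega)])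
  rw [abs_expect_blockLift_edgeIndicator] at hbox
  have hμ : H.edgeDensity ^ 2 ^ (m + 1) ≤ 1 := pow_le_one₀ H.edgeDensity_nonneg H.edgeDensity_le_one
  calc _ ≤ (H.edgeDensity ^ 2 ^ (m + 1)) ^ 2 + (2 * H.edgeDensity ^ 2 ^ (m + 1) + 1) * θ + θ ^ 2 :=
        hbox.trans_eq (by ring)
    _ ≤ (H.edgeDensity ^ 2 ^ (m + 1)) ^ 2 + (2 * 1 + 1) * θ + θ ^ 2 := by gcongr
    _ = _ := by rw [← pow_mul, ← pow_succ]; ring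

theorem abs_flatten_adjacencyMap_sub_le (hc : 2 ≤ c.length)
    (hcd : Nat.Partition.ofComposition k c = Nat.Partition.ofComposition k d) (hN : 2 ≤ N)
    {x : ∀ i, EuclideanSpace ℝ (Fin (d.blocksFun i) → V)} (hx : ∀ i, ‖x i‖ = 1) :
    |flatten (adjacencyMap H) d x - H.edgeDensity * flatten (allOnesMap V k) d x| ≤
      √(Fintype.card V) ^ k * discrepancyBound c.length N (cycleExcess c N H) := by
  obtain ⟨m, h⟩ := Nat.exists_eq_add_of_le' hc
  obtain ⟨β, ρ, hρ⟩ := exists_perm_of_ofComposition_eq hcd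
  have hexcess := cycleExcess_nonneg H hc hN
  have herror : 0 ≤ 3 * cycleExcess c N H ^ (N : ℝ)⁻¹ + (cycleExcess c N H ^ (N : ℝ)⁻¹) ^ 2 := by
    positivity
  have hbox : 0 ≤ boxValue (m + 2) (blockLift (attachLast h ∘ c.index) H.edgeIndicator) := by
    rw [boxValue_succ]
    exact expect_nonneg fun _ _ => sq_nonneg _
  rw [discrepancyBound, h]
  refine abs_flatten_tensorForm_sub_le (blk := attachLast h ∘ c.index) (β := β.trans (attachLast h))
    (fun q => congrArg (attachLast h) (hρ q)) (fun v => H.edgeIndicator_comp_perm v ρ)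
    (Real.rpow_nonneg herror _) ?_ fun i => (hx i).le
  rw [Real.rpow_inv_natCast_pow herror (by positivity), abs_of_nonneg hbox,
    ← expect_blockLift (attachLast h ∘ c.index), abs_expect_blockLift_edgeIndicator]
  exact boxValue_blockLift_edgeIndicator_le H h hN

theorem discrepancyBound_nonneg (hc : 2 ≤ c.length) (hN : 2 ≤ N) :
    0 ≤ discrepancyBound c.length N (cycleExcess c N H) := by
  have hexcess := cycleExcess_nonneg H hc hN
  unfold discrepancyBound
  positivity

theorem abs_eig1_sub_mul_le (hc : 2 ≤ c.length)
    (hcd : Nat.Partition.ofComposition k c = Nat.Partition.ofComposition k d) (hN : 2 ≤ N)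
    (p : ℝ) : |eig1 H d - p * √(Fintype.card V) ^ k| ≤ √(Fintype.card V) ^ k *
      (discrepancyBound c.length N (cycleExcess c N H) + |H.edgeDensity - p|) := by
  have hδ := discrepancyBound_nonneg H hc hN
  calc |eig1 H d - p * √(Fintype.card V) ^ k|
      = |(eig1 H d - √(Fintype.card V) ^ k * H.edgeDensity) +
          √(Fintype.card V) ^ k * (H.edgeDensity - p)| := by ring_nf
    _ ≤ |eig1 H d - √(Fintype.card V) ^ k * H.edgeDensity| +
          √(Fintype.card V) ^ k * |H.edgeDensity - p| := by
        refine (abs_add_le _ _).trans_eq ?_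
        rw [abs_mul, abs_of_pos (sqrt_card_pow_pos k)]
    _ ≤ _ := by
        rw [mul_add]
        gcongr
        exact abs_eig1_sub_le (by positivity) fun x hx =>
          abs_flatten_adjacencyMap_sub_le H hc hcd hN hx

theorem abs_eig2_le_mul (hc : 2 ≤ c.length)
    (hcd : Nat.Partition.ofComposition k c = Nat.Partition.ofComposition k d) (hN : 2 ≤ N) :
    |eig2 H d| ≤ √(Fintype.card V) ^ k * (discrepancyBound c.length N (cycleExcess c N H) +
      ((Fintype.card V).ascFactorial k / (Fintype.card V : ℝ) ^ k - 1)) := by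
  have hδ := discrepancyBound_nonneg H hc hN
  rw [mul_add]
  exact abs_eig2_le (by positivity) fun x hx => abs_flatten_adjacencyMap_sub_le H hc hcd hN hx

end CycleDiscrepancy

section Asymptotics

open Topology

theorem isLittleO_of_abs_le_mul {α : Type*} {l : Filter α} {f g e : α → ℝ}
    (he : Tendsto e l (𝓝 0)) (h : ∀ᶠ x in l, |f x| ≤ g x * e x) : f =o[l] g := by
  have hO : f =O[l] fun x => g x * e x :=
    .of_bound 1 (h.mono fun x hx => by simpa using hx.trans (le_abs_self _))
  exact hO.trans_isLittleO
    (by simpa using (isBigO_refl g l).mul_isLittleO ((isLittleO_one_iff ℝ).mpr he))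

theorem tendsto_of_pow_le {α : Type*} {l : Filter α} {p : ℝ} (hp : 0 ≤ p) {D : ℕ} (hD : D ≠ 0)
    {μ lo hi : α → ℝ} (hlo : Tendsto lo l (𝓝 p)) (hle : ∀ᶠ x in l, lo x ≤ μ x)
    (hhi : Tendsto hi l (𝓝 (p ^ D))) (hup : ∀ᶠ x in l, 0 ≤ μ x ∧ μ x ^ D ≤ hi x) :
    Tendsto μ l (𝓝 p) := by
  have hroot := hhi.rpow_const (p := (D : ℝ)⁻¹) (Or.inr (by positivity))
  rw [Real.pow_rpow_inv_natCast hp hD] at hroot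
  refine tendsto_of_tendsto_of_tendsto_of_le_of_le' hlo hroot hle (hup.mono fun x hx => ?_)
  obtain ⟨hnonneg, hpow⟩ := hx
  rw [← Real.pow_rpow_inv_natCast hnonneg hD]
  gcongr

theorem tendsto_ascFactorial_div_pow (k : ℕ) :
    Tendsto (fun n : ℕ => (n.ascFactorial k : ℝ) / (n : ℝ) ^ k) atTop (𝓝 1) := by
  induction k with
  | zero => simp
  | succ k ih =>
    have hfactor : Tendsto (fun n : ℕ => ((n : ℝ) + k) / n) atTop (𝓝 1) := by
      have hsum : Tendsto (fun n : ℕ => 1 + (k : ℝ) / n) atTop (𝓝 1) := by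
        simpa using (tendsto_const_div_atTop_nhds_zero_nat (k : ℝ)).const_add 1
      refine hsum.congr' ?_
      filter_upwards [eventually_ne_atTop 0] with n hn
      field_simp
    refine (one_mul (1 : ℝ) ▸ hfactor.mul ih).congr fun n => ?_
    rw [Nat.ascFactorial_succ, pow_succ', div_mul_div_comm, Nat.cast_mul, Nat.cast_add]

theorem tendsto_descFactorial_div_pow (k : ℕ) :
    Tendsto (fun n : ℕ => (n.descFactorial k : ℝ) / (n : ℝ) ^ k) atTop (𝓝 1) := by
  refine (isEquivalent_iff_tendsto_one ?_).mp (isEquivalent_descFactorial k)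
  filter_upwards [eventually_ne_atTop 0] with n hn
  positivity

theorem LoopHypergraph.le_edgeDensity {V : Type*} [Fintype V] [Nonempty V] {k : ℕ} {p : ℝ}
    {H : LoopHypergraph V k} (hE : p * (Fintype.card V).choose k ≤ H.edges.card) :
    p * ((Fintype.card V).descFactorial k / (Fintype.card V : ℝ) ^ k) -
      ((Fintype.card V).ascFactorial k / (Fintype.card V : ℝ) ^ k - 1) ≤ H.edgeDensity := by
  have hcount : p * ((Fintype.card V).descFactorial k / (Fintype.card V : ℝ) ^ k) ≤
      (k.factorial * H.edges.card : ℝ) / (Fintype.card V : ℝ) ^ k := by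
    rw [← mul_div_assoc, Nat.descFactorial_eq_factorial_mul_choose, Nat.cast_mul, mul_left_comm]
    gcongr
  linarith [(abs_le.mp H.abs_factorial_mul_card_edges_div_sub_edgeDensity_le).2]

variable {k : ℕ} {V : ℕ → Type*} [∀ n, Fintype (V n)] (hV : ∀ n, Fintype.card (V n) = n)
  {H : ∀ n, LoopHypergraph (V n) k} {p : ℝ}
include hV

theorem eventually_nonempty : ∀ᶠ n in atTop, Nonempty (V n) := by
  filter_upwards [eventually_ne_atTop 0] with n hn
  exact Fintype.card_pos_iff.mp (by rw [hV]; omega)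

theorem exists_tendsto_homDensity_le {U : Type*} [Fintype U] [DecidableEq U]
    {F : LoopHypergraph U k} {x : ℝ}
    (hF : ∃ g : ℕ → ℝ, g =o[atTop] (fun n : ℕ => (n : ℝ) ^ Fintype.card U) ∧
      ∀ n : ℕ, (F.labeledCopies (H n) : ℝ) ≤ x * (n : ℝ) ^ Fintype.card U + g n) :
    ∃ u : ℕ → ℝ, Tendsto u atTop (𝓝 x) ∧ ∀ᶠ n in atTop, F.homDensity (H n) ≤ u n := by
  obtain ⟨g, hg, hcopies⟩ := hF
  refine ⟨fun n => x + g n / (n : ℝ) ^ Fintype.card U +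
    (1 - n.descFactorial (Fintype.card U) / (n : ℝ) ^ Fintype.card U), ?_, ?_⟩
  · simpa using (hg.tendsto_div_nhds_zero.const_add x).add
      ((tendsto_descFactorial_div_pow (Fintype.card U)).const_sub 1)
  · filter_upwards [eventually_nonempty hV, eventually_ne_atTop 0] with n _ hn
    have hpos : 0 < (n : ℝ) ^ Fintype.card U := by positivity
    refine (F.homDensity_le (H n)).trans ?_
    rw [hV]
    gcongr
    rw [div_le_iff₀ hpos, add_mul, div_mul_cancel₀ _ hpos.ne']
    exact hcopies n

theorem tendsto_edgeDensity (hp : 0 ≤ p)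
    (hE : ∀ n : ℕ, p * (n.choose k : ℝ) ≤ ((H n).edges.card : ℝ)) {D : ℕ} (hD : D ≠ 0)
    {u : ℕ → ℝ} (hu : Tendsto u atTop (𝓝 (p ^ D)))
    (hup : ∀ᶠ n in atTop, (H n).edgeDensity ^ D ≤ u n) :
    Tendsto (fun n => (H n).edgeDensity) atTop (𝓝 p) := by
  have hlo : Tendsto (fun n : ℕ => p * (n.descFactorial k / (n : ℝ) ^ k) -
      (n.ascFactorial k / (n : ℝ) ^ k - 1)) atTop (𝓝 p) := by
    simpa using ((tendsto_descFactorial_div_pow k).const_mul p).sub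
      ((tendsto_ascFactorial_div_pow k).sub_const 1)
  refine tendsto_of_pow_le hp hD hlo ?_ hu
    (hup.mono fun n hn => ⟨(H n).edgeDensity_nonneg, hn⟩)
  filter_upwards [eventually_nonempty hV] with n _
  simpa only [hV] using LoopHypergraph.le_edgeDensity (H := H n) (by rw [hV]; exact hE n)

/-- As the cycle excess is nonnegative, `u` also bounds the edge density from above. -/
theorem tendsto_edgeDensity_and_cycleExcess (hp : 0 ≤ p)
    (hE : ∀ n : ℕ, p * (n.choose k : ℝ) ≤ ((H n).edges.card : ℝ)) {c : Composition k}
    (hc : 2 ≤ c.length) {N : ℕ} (hN : 2 ≤ N) {u : ℕ → ℝ}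
    (hu : Tendsto u atTop (𝓝 (p ^ (cycleHypergraph c N).edges.card)))
    (hup : ∀ᶠ n in atTop, (cycleHypergraph c N).homDensity (H n) ≤ u n) :
    Tendsto (fun n => (H n).edgeDensity) atTop (𝓝 p) ∧
      Tendsto (fun n => cycleExcess c N (H n)) atTop (𝓝 0) := by
  obtain ⟨m, h⟩ := Nat.exists_eq_add_of_le' hc
  have hnonneg : ∀ᶠ n in atTop, 0 ≤ cycleExcess c N (H n) :=
    (eventually_nonempty hV).mono fun n _ => cycleExcess_nonneg (H n) hc hN
  have hμ := tendsto_edgeDensity hV hp hE (by rw [card_edges_cycleHypergraph h hN]; positivity) hu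
    (by filter_upwards [hup, hnonneg] with n hn hn' using (sub_nonneg.mp hn').trans hn)
  refine ⟨hμ, squeeze_zero' hnonneg (hup.mono fun n hn => sub_le_sub_right hn _) ?_⟩
  simpa using hu.sub (hμ.pow (cycleHypergraph c N).edges.card)

end Asymptotics

theorem theorem1_general {k : ℕ} (p : ℝ) (hp : 0 ≤ p)
    (V : ℕ → Type*) [∀ n, Fintype (V n)] (hV : ∀ n, Fintype.card (V n) = n)
    (H : ∀ n, LoopHypergraph (V n) k)
    (hE : ∀ n : ℕ, p * (n.choose k : ℝ) ≤ ((H n).edges.card : ℝ))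
    (π : Nat.Partition k) (hπ : 2 ≤ π.parts.card) (N : ℕ) (hN : 2 ≤ N)
    (c : Composition k) (hc : Nat.Partition.ofComposition k c = π)
    (hcycle : ∃ g : ℕ → ℝ,
      g =o[atTop] (fun n : ℕ => (n : ℝ) ^ Fintype.card (CycleVertex c N)) ∧
      ∀ n : ℕ, (((cycleHypergraph c N).labeledCopies (H n) : ℕ) : ℝ) ≤
        p ^ (cycleHypergraph c N).edges.card *
          (n : ℝ) ^ Fintype.card (CycleVertex c N) + g n)
    (d : Composition k) (hd : Nat.Partition.ofComposition k d = π) :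
    ((fun n : ℕ => eig1 (H n) d - p * (n : ℝ) ^ ((k : ℝ) / 2))
        =o[atTop] fun n : ℕ => (n : ℝ) ^ ((k : ℝ) / 2)) ∧
    ((fun n : ℕ => eig2 (H n) d) =o[atTop] fun n : ℕ => (n : ℝ) ^ ((k : ℝ) / 2)) := by
  have hlen : 2 ≤ c.length := by
    rwa [← c.blocks_length, ← Multiset.coe_card, ← show π.parts = c.blocks by rw [← hc]; rfl]
  obtain ⟨u, hu, hup⟩ := exists_tendsto_homDensity_le hV hcycle
  obtain ⟨hμ, hexcess⟩ := tendsto_edgeDensity_and_cycleExcess hV hp hE hlen hN hu hup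
  have hδ := (tendsto_discrepancyBound c.length (by omega : N ≠ 0)).comp hexcess
  simp only [Real.rpow_div_two_eq_sqrt _ (Nat.cast_nonneg _), Real.rpow_natCast]
  refine ⟨isLittleO_of_abs_le_mul (by simpa using hδ.add (hμ.sub_const p).abs) ?_,
    isLittleO_of_abs_le_mul
      (by simpa using hδ.add ((tendsto_ascFactorial_div_pow k).sub_const 1)) ?_⟩
  · filter_upwards [eventually_nonempty hV] with n _
    simpa only [hV] using abs_eig1_sub_mul_le (H n) hlen (hc.trans hd.symm) hN p
  · filter_upwards [eventually_nonempty hV] with n _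
    simpa only [hV] using abs_eig2_le_mul (H n) hlen (hc.trans hd.symm) hN

theorem theorem1 {k : ℕ} (p : ℝ) (hp0 : 0 < p) (hp1 : p < 1)
    (V : ℕ → Type*) [∀ n, Fintype (V n)] (hV : ∀ n, Fintype.card (V n) = n)
    (H : ∀ n, LoopHypergraph (V n) k)
    (hE : ∀ n : ℕ, p * (n.choose k : ℝ) ≤ ((H n).edges.card : ℝ))
    (π : Nat.Partition k) (hπ : 2 ≤ π.parts.card)
    (ℓ : ℕ) (hℓ : 1 ≤ ℓ)
    -- an ordering `c` of `π`, used to form the cycle of length `4 * ℓ`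
    (c : Composition k) (hc : Nat.Partition.ofComposition k c = π)
    (hcycle : ∃ g : ℕ → ℝ,
      g =o[atTop] (fun n : ℕ => (n : ℝ) ^ Fintype.card (CycleVertex c (2 * ℓ))) ∧
      ∀ n : ℕ, (((cycleHypergraph c (2 * ℓ)).labeledCopies (H n) : ℕ) : ℝ) ≤
        p ^ (cycleHypergraph c (2 * ℓ)).edges.card *
          (n : ℝ) ^ Fintype.card (CycleVertex c (2 * ℓ)) + g n)
    -- any ordering `d` of `π`, used to form the eigenvalues
    (d : Composition k) (hd : Nat.Partition.ofComposition k d = π) :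
    ((fun n : ℕ => eig1 (H n) d - p * (n : ℝ) ^ ((k : ℝ) / 2))
        =o[atTop] fun n : ℕ => (n : ℝ) ^ ((k : ℝ) / 2)) ∧
    ((fun n : ℕ => eig2 (H n) d) =o[atTop] fun n : ℕ => (n : ℝ) ^ ((k : ℝ) / 2)) :=
  theorem1_general p hp0.le V hV H hE π hπ (2 * ℓ) (by omega) c hc hcycle d hd
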